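/- Operators act on finite-dimensional complex Hilbert spaces. For a function $f:(0,\infty)\to\mathbb R$, positive semi-definite $X$ and positive definite $Z,\tau$ on $\mathcal H_S$, put $$\widetilde Q_f(X\|Z;\tau)=\langle\varphi^X|\,f(\tau_S^{-1}\otimes Z_{\hat S}^{T})\,|\varphi^X\rangle,\qquad |\varphi^X\rangle=(X^{1/2}\otimes I)\sum_i|i\rangle_S|i\rangle_{\hat S},$$ where the transpose is taken in the basis $\{|i\rangle\}$, and for positive semi-definite $X,Y$ let the optimized $f$-divergence be $$\widetilde Q_f(X\|Y)=\sup_{\tau>0,\ \operatorname{Tr}\tau\le1,\ \varepsilon>0}\widetilde Q_f(X\|Y+\varepsilon\Pi_Y^{\perp};\tau)\in[-\infty,+\infty],$$ with $\Pi_Y^\perp$ the projection onto $\ker Y$. For positive semi-definite $Z$ let $\|Z\|_\alpha=[\operatorname{Tr}Z^\alpha]^{1/\alpha}$ for $0<\alpha<\infty$ and let $\|Z\|_\infty$ be the operator norm. Negative powers are taken on the support. For $\alpha=\infty$ read $(1-\alpha)/\alpha=-1$ and $\alpha/(\alpha-1)=1$. Set $N_\alpha(X,Y)=\big\|Y^{(1-\alpha)/2\alpha}XY^{(1-\alpha)/2\alpha}\big\|_\alpha$.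 A function $f$ is operator anti-monotone on $(0,\infty)$ if $A\le B$ implies $f(B)\le f(A)$ for all Hermitian $A,B$ with spectrum in $(0,\infty)$. 1. Let $\alpha\in[1/2,1)$ and $f(x)=-x^{(1-\alpha)/\alpha}$. Then $f$ is operator anti-monotone on $(0,\infty)$ and, for all positive semi-definite $X,Y$ on $\mathcal H_S$, $\widetilde Q_f(X\|Y)=-N_\alpha(X,Y)$. 2. Let $\alpha\in(1,\infty]$ and $f(x)=x^{(1-\alpha)/\alpha}$. Then $f$ is operator anti-monotone on $(0,\infty)$ and, for all positive semi-definite $X,Y$ on $\mathcal H_S$, $\widetilde Q_f(X\|Y)=N_\alpha(X,Y)$ if $\operatorname{supp}X\subseteq\operatorname{supp}Y$, and $\widetilde Q_f(X\|Y)=+\infty$ otherwise. 3. Define the sandwiched Rényi relative entropy by $\widetilde D_\alpha(X\|Y)=\frac{\alpha}{\alpha-1}\log N_\alpha(X,Y)$ (with $\log0=-\infty$), except that $\widetilde D_\alpha(X\|Y)=+\infty$ if $\alpha>1$ and $\operatorname{supp}X\not\subseteq\operatorname{supp}Y$. Then for every $\alpha\in[1/2,1)\cup(1,\infty]$, all positive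 semi-definite $X,Y$ on $\mathcal H_S$ and every completely positive trace-preserving linear map $\mathcal N$ from operators on $\mathcal H_S$ to operators on $\mathcal H_B$, $$\widetilde D_\alpha(X\|Y)\ge\widetilde D_\alpha(\mathcal N(X)\|\mathcal N(Y)).$$ -/

import Mathlib

open scoped ENNReal Kronecker ComplexOrder

/-! Operators on finite-dimensional Hilbert spaces are complex square matrices indexed by a finite
type; positive (semi-)definiteness is that of Mathlib. -/

namespace SandwichedRenyi

section Operators

variable {S B : Type*} [Fintype S] [DecidableEq S] [Fintype B] [DecidableEq B]

/-- The power `Y ^ s` of a positive semi-definite `Y` for real `s ≠ 0`, by the functional calculus.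
As `0 ^ s = 0` for real `s ≠ 0`, also for `s < 0`, negative powers are taken on the support of `Y`
and vanish on the kernel of `Y`. -/
noncomputable def psdPow (Y : Matrix S S ℂ) (s : ℝ) : Matrix S S ℂ :=
  cfc (fun x : ℝ => x ^ s) Y

/-- The projection onto the kernel of a Hermitian `Y`, as the spectral projection of `Y` for the
eigenvalue `0`; see the lemmas `kerProj_isHermitian`, `kerProj_mul_self` and
`kerProj_mulVec_eq_self_iff`. -/
noncomputable def kerProj (Y : Matrix S S ℂ) : Matrix S S ℂ :=
  cfc (fun x : ℝ => if x = 0 then 1 else 0) Y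

theorem kerProj_isHermitian (Y : Matrix S S ℂ) : (kerProj Y).IsHermitian :=
  cfc_predicate (R := ℝ) _ Y

theorem kerProj_mul_self (Y : Matrix S S ℂ) : kerProj Y * kerProj Y = kerProj Y := by
  have hc : ContinuousOn (fun x : ℝ => if x = 0 then (1 : ℝ) else 0) (spectrum ℝ Y) :=
    (Matrix.finite_real_spectrum (A := Y)).continuousOn _
  unfold kerProj
  rw [← cfc_mul _ _ Y hc hc]
  congr 1
  funext x
  split_ifs <;> simp

theorem mul_kerProj {Y : Matrix S S ℂ} (hY : Y.IsHermitian) : Y * kerProj Y = 0 := by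
  have hs : IsSelfAdjoint Y := hY
  have hc : ∀ g : ℝ → ℝ, ContinuousOn g (spectrum ℝ Y) := fun g =>
    (Matrix.finite_real_spectrum (A := Y)).continuousOn g
  have h : cfc (fun x : ℝ => x * (if x = 0 then 1 else 0)) Y = Y * kerProj Y := by
    rw [cfc_mul _ _ Y (hc _) (hc _), cfc_id' ℝ Y]
    rfl
  rw [← h]
  have h0 : (fun x : ℝ => x * (if x = 0 then (1 : ℝ) else 0)) = fun _ => 0 := by
    funext x
    split_ifs with hx <;> simp [hx]
  rw [h0, cfc_const_zero]

theorem one_eq_kerProj_add {Y : Matrix S S ℂ} (hY : Y.IsHermitian) :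
    1 = kerProj Y + cfc (fun x : ℝ => x⁻¹) Y * Y := by
  have hs : IsSelfAdjoint Y := hY
  have hc : ∀ g : ℝ → ℝ, ContinuousOn g (spectrum ℝ Y) := fun g =>
    (Matrix.finite_real_spectrum (A := Y)).continuousOn g
  have h1 : cfc (fun x : ℝ => x⁻¹ * x) Y = cfc (fun x : ℝ => x⁻¹) Y * Y := by
    rw [cfc_mul _ _ Y (hc _) (hc _), cfc_id' ℝ Y]
  rw [← h1, kerProj, ← cfc_add _ _ _ (hc _) (hc _), ← cfc_const_one ℝ Y]
  congr 1
  funext x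
  by_cases hx : x = 0 <;> simp [hx]

/-- The range of `kerProj Y` is exactly the kernel of `Y`. -/
theorem kerProj_mulVec_eq_self_iff {Y : Matrix S S ℂ} (hY : Y.IsHermitian) (v : S → ℂ) :
    Matrix.mulVec (kerProj Y) v = v ↔ Matrix.mulVec Y v = 0 := by
  constructor
  · intro h
    rw [← h, Matrix.mulVec_mulVec, mul_kerProj hY, Matrix.zero_mulVec]
  · intro h
    have h1 := congrArg (fun M => Matrix.mulVec M v) (one_eq_kerProj_add hY)
    simp only [Matrix.one_mulVec, Matrix.add_mulVec, ← Matrix.mulVec_mulVec, h,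
      Matrix.mulVec_zero, add_zero] at h1
    exact h1.symm

/-- The support of a Hermitian `X`: the orthogonal complement of its kernel. -/
noncomputable def supp (X : Matrix S S ℂ) : Submodule ℂ (EuclideanSpace ℂ S) :=
  (LinearMap.ker (Matrix.toEuclideanLin X))ᗮ

/-- The unnormalized maximally entangled vector `|Γ⟩ = ∑ i, |i⟩|i⟩`. -/
def maxEntangled (S : Type*) [DecidableEq S] : S × S → ℂ :=
  fun p => if p.1 = p.2 then 1 else 0

/-- The vector `|φ^X⟩ = (X^{1/2} ⊗ I) |Γ⟩`. -/
noncomputable def phiVec (X : Matrix S S ℂ) : S × S → ℂ :=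
  Matrix.mulVec (psdPow X (1 / 2) ⊗ₖ (1 : Matrix S S ℂ)) (maxEntangled S)

/-- `⟨φ^X| f(τ⁻¹ ⊗ Zᵀ) |φ^X⟩` for positive definite `Z` and `τ`. Only the values of `f` on `(0, ∞)`
matter, as `τ⁻¹ ⊗ Zᵀ` is positive definite. -/
noncomputable def fDivAt (f : ℝ → ℝ) (X Z τ : Matrix S S ℂ) : ℝ :=
  (star (phiVec X) ⬝ᵥ Matrix.mulVec (cfc f (τ⁻¹ ⊗ₖ Z.transpose)) (phiVec X)).re

/-- The optimized quantum `f`-divergence of positive semi-definite `X` and `Y`, with values in the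
extended reals: the supremum of `⟨φ^X| f(τ⁻¹ ⊗ (Y + ε Π)ᵀ) |φ^X⟩`, where `Π` is the projection onto
the kernel of `Y`, over all `τ > 0` with `Tr τ ≤ 1` and all `ε > 0`. -/
noncomputable def optFDiv (f : ℝ → ℝ) (X Y : Matrix S S ℂ) : EReal :=
  ⨆ (τ : Matrix S S ℂ) (_ : τ.PosDef ∧ τ.trace.re ≤ 1) (ε : ℝ) (_ : 0 < ε),
    (fDivAt f X (Y + (ε : ℂ) • kerProj Y) τ : EReal)

/-- `‖Z‖_α` for positive semi-definite `Z`: `(Tr Z^α)^{1/α}` for finite `α > 0`, and the operator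
norm (on the Euclidean space) for `α = ∞`. -/
noncomputable def alphaNorm (α : ℝ≥0∞) (Z : Matrix S S ℂ) : ℝ :=
  if α = ∞ then ‖Matrix.toEuclideanCLM (n := S) (𝕜 := ℂ) Z‖
  else (psdPow Z α.toReal).trace.re ^ (1 / α.toReal)

/-- The exponent `(1 - α) / α`, which is `-1` for `α = ∞`. -/
noncomputable def renyiExp (α : ℝ≥0∞) : ℝ :=
  if α = ∞ then -1 else (1 - α.toReal) / α.toReal

/-- The prefactor `α / (α - 1)`, which is `1` for `α = ∞`. -/
noncomputable def renyiPrefactor (α : ℝ≥0∞) : ℝ :=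
  if α = ∞ then 1 else α.toReal / (α.toReal - 1)

/-- The sandwiched norm `‖Y^{(1-α)/2α} X Y^{(1-α)/2α}‖_α`. -/
noncomputable def sandwichedNorm (α : ℝ≥0∞) (X Y : Matrix S S ℂ) : ℝ :=
  alphaNorm α (psdPow Y (renyiExp α / 2) * X * psdPow Y (renyiExp α / 2))

open Classical in
/-- The sandwiched Rényi relative entropy
`α / (α - 1) * log ‖Y^{(1-α)/2α} X Y^{(1-α)/2α}‖_α`, set to `+∞` if `α > 1` and `supp X` is not
contained in `supp Y`. The logarithm is extended by `log 0 = -∞`. -/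
noncomputable def sandwichedEntropy (α : ℝ≥0∞) (X Y : Matrix S S ℂ) : EReal :=
  if 1 < α ∧ ¬ supp X ≤ supp Y then ⊤
  else (renyiPrefactor α : EReal) * ENNReal.log (ENNReal.ofReal (sandwichedNorm α X Y))

/-- `f : (0, ∞) → ℝ` is operator anti-monotone: `A ≤ B` implies `f(B) ≤ f(A)`, for all matrices
of any size with spectrum in `(0, ∞)`, in the Loewner order. -/
def OperatorAntitone (f : ℝ → ℝ) : Prop :=
  ∀ (k : ℕ) (P Q : Matrix (Fin k) (Fin k) ℂ), P.PosDef → Q.PosDef →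
    (Q - P).PosSemidef → (cfc f P - cfc f Q).PosSemidef

open scoped Matrix.Norms.L2Operator MatrixOrder CStarAlgebra in
/-- A quantum channel: a completely positive trace-preserving linear map. (The operator norm and the
Loewner order are the structure in which complete positivity is stated in Mathlib.) -/
structure IsQuantumChannel (N : Matrix S S ℂ →ₗ[ℂ] Matrix B B ℂ) : Prop where
  completelyPositive : ∃ Φ : Matrix S S ℂ →CP Matrix B B ℂ, ∀ M, Φ M = N M
  tracePreserving : ∀ M : Matrix S S ℂ, (N M).trace = M.trace

end Operators

end SandwichedRenyi

/-! Put p = (1-α)/α, so that p lies in (0,1] for α in [1/2,1) and in [-1,0) for α > 1. In eigenbases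
of τ and Z the functional calculus of the tensor product factorises, and for x^p the divergence at
(τ, ε) becomes Tr τ^{-p} M + ε^p Tr τ^{-p} E, with M = X^{1/2} Y^p X^{1/2} and E = X^{1/2} Π
X^{1/2}, Π being the projection onto ker Y (`fDivAt_rpow_add_smul_kerProj`).

Value of the supremum. Expanding Tr τ^{-p} M in two eigenbases gives a sum with doubly stochastic
weights. Hölder (p < 0) or reverse Hölder (p > 0) then shows that ‖M‖_α is the supremum,
respectively the infimum, over τ; it is approached along normalisations of M^α + η, or, for α = ∞,
by τ concentrating on a top eigenvector (`exists_posDef_alphaNorm`). Moreover M and Y^{p/2} X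
Y^{p/2} are of the form A Aᴴ and Aᴴ A, hence have the same α-norm. The term with E can be made small
if p > 0. If p < 0 it vanishes when supp X ⊆ supp Y, and otherwise it is unbounded as ε tends to 0.

Monotonicity. Let A = τ⁻¹ ⊗ Zᵀ and A' = τ'⁻¹ ⊗ Z'ᵀ. The map V : W ↦ X^{1/2} N†(N(X)^{-1/2} W) is a
contraction whose adjoint takes φ^X to φ^{N(X)}, and Vᴴ A V ≤ A' whenever N(Z) ≤ Z' and τ dominates
the pull-back of τ' (`petzMap_contraction`, `trace_sqrt_mul_petzMap`, `petzMap_modular`). Both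
inequalities need only the 2-positivity of N† and Schur complements. They give ⟨φ'|(A'+t)⁻¹|φ'⟩ ≤
⟨φ|(A+t)⁻¹|φ⟩ for all t > 0, and the integral representation of powers carries this over to x^p and
-x^p (`re_cfc_rpow_le`). With V the identity this is operator anti-monotonicity; with V as above it
is data processing for `optFDiv`, after a rescaling that repairs the constraints on τ and ε
(`optFDiv_map_le`). Data processing for the entropies follows by inserting the values of the
supremum. -/

namespace SandwichedRenyi

/-! ### Spectral calculus in eigenbases and the trace form of the divergence. -/

section Spectral

open Matrix

variable {S : Type*} [Fintype S] [DecidableEq S]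

/-- The matrix `U diag(d) Uᴴ`. -/
noncomputable def conjDiag (U : Matrix S S ℂ) (d : S → ℝ) : Matrix S S ℂ :=
  U * diagonal (fun i => (d i : ℂ)) * Uᴴ

theorem conjDiag_isHermitian (U : Matrix S S ℂ) (d : S → ℝ) : (conjDiag U d).IsHermitian := by
  have h : (diagonal (fun i => (d i : ℂ)))ᴴ = diagonal (fun i => (d i : ℂ)) := by
    rw [diagonal_conjTranspose]
    congr 1
    funext i
    simp
  unfold conjDiag
  rw [Matrix.IsHermitian, conjTranspose_mul, conjTranspose_mul, conjTranspose_conjTranspose, h,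
    Matrix.mul_assoc]

theorem conjDiag_add (U : Matrix S S ℂ) (d e : S → ℝ) :
    conjDiag U (d + e) = conjDiag U d + conjDiag U e := by
  unfold conjDiag
  rw [← Matrix.add_mul, ← Matrix.mul_add, diagonal_add]
  simp

theorem conjDiag_smul (U : Matrix S S ℂ) (c : ℝ) (d : S → ℝ) :
    conjDiag U (c • d) = (c : ℂ) • conjDiag U d := by
  have h : diagonal (fun i => ((c • d) i : ℂ)) = (c : ℂ) • diagonal (fun i => (d i : ℂ)) := by
    rw [← diagonal_smul]
    congr 1
    funext i
    simp
  unfold conjDiag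
  rw [h, Matrix.mul_smul, Matrix.smul_mul]

theorem conjDiag_one {U : Matrix S S ℂ} (hU : Uᴴ * U = 1) : conjDiag U 1 = 1 := by
  simpa [conjDiag] using mul_eq_one_comm.mp hU

theorem conjDiag_mul {U : Matrix S S ℂ} (hU : Uᴴ * U = 1) (d e : S → ℝ) :
    conjDiag U d * conjDiag U e = conjDiag U (d * e) := by
  unfold conjDiag
  have : U * diagonal (fun i => (d i : ℂ)) * Uᴴ * (U * diagonal (fun i => (e i : ℂ)) * Uᴴ) =
      U * diagonal (fun i => (d i : ℂ)) * (Uᴴ * U) * diagonal (fun i => (e i : ℂ)) * Uᴴ := by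
    simp only [Matrix.mul_assoc]
  rw [this, hU, Matrix.mul_one, Matrix.mul_assoc U, diagonal_mul_diagonal]
  simp

/-- `d ↦ U diag(d) Uᴴ` as an algebra homomorphism. -/
noncomputable def conjDiagAlgHom {U : Matrix S S ℂ} (hU : Uᴴ * U = 1) :
    (S → ℝ) →ₐ[ℝ] Matrix S S ℂ :=
  AlgHom.ofLinearMap
    { toFun := conjDiag U
      map_add' := conjDiag_add U
      map_smul' := fun c d => by
        rw [conjDiag_smul]
        ext i j
        simp }
    (conjDiag_one hU) (fun d e => (conjDiag_mul hU d e).symm)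

open Polynomial in
-- On finitely many points `f` agrees with a polynomial, and polynomials commute with the algebra
-- homomorphism `conjDiagAlgHom`.
theorem cfc_conjDiag {U : Matrix S S ℂ} (hU : Uᴴ * U = 1) (f : ℝ → ℝ) (d : S → ℝ) :
    cfc f (conjDiag U d) = conjDiag U (fun i => f (d i)) := by
  classical
  set A := conjDiag U d with hA
  have hfin : (spectrum ℝ A).Finite := Matrix.finite_real_spectrum (A := A)
  -- Interpolating on the spectrum and on the entries of `d` together makes it unnecessary to know
  -- that the two sets coincide.
  set s : Finset ℝ := hfin.toFinset ∪ Finset.univ.image d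
  set q : ℝ[X] := Lagrange.interpolate s id f with hq
  have hqe : ∀ x ∈ s, q.eval x = f x := fun x hx =>
    Lagrange.eval_interpolate_at_node (v := id) f Function.injective_id.injOn hx
  have h1 : cfc f A = cfc (fun x => q.eval x) A :=
    cfc_congr fun x hx => (hqe x (by simp [s, hx])).symm
  have h2 : A = conjDiagAlgHom hU d := rfl
  have hsa : IsSelfAdjoint A := conjDiag_isHermitian U d
  rw [h1, cfc_polynomial q A hsa, h2, aeval_algHom_apply]
  change conjDiag U (aeval d q) = _
  congr 1
  funext i
  have h3 : (aeval d q) i = aeval (d i) q :=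
    (aeval_algHom_apply (Pi.evalAlgHom ℝ (fun _ : S => ℝ) i) d q).symm
  rw [h3, ← hqe (d i) (by simp [s])]
  simp [Polynomial.aeval_def, Polynomial.eval₂_eq_eval_map]

theorem exists_conjDiag {A : Matrix S S ℂ} (hA : A.IsHermitian) :
    ∃ (U : Matrix S S ℂ) (d : S → ℝ), Uᴴ * U = 1 ∧ A = conjDiag U d ∧ d = hA.eigenvalues := by
  refine ⟨hA.eigenvectorUnitary, hA.eigenvalues, ?_, ?_, rfl⟩
  · have := (Matrix.mem_unitaryGroup_iff' (A := (hA.eigenvectorUnitary : Matrix S S ℂ))).mp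
      hA.eigenvectorUnitary.2
    exact this
  · exact hA.spectral_theorem

theorem PosSemidef.exists_conjDiag {A : Matrix S S ℂ} (hA : A.PosSemidef) :
    ∃ (U : Matrix S S ℂ) (d : S → ℝ), Uᴴ * U = 1 ∧ A = conjDiag U d ∧ ∀ i, 0 ≤ d i := by
  obtain ⟨U, d, hU, h, rfl⟩ := SandwichedRenyi.exists_conjDiag hA.isHermitian
  exact ⟨U, _, hU, h, hA.eigenvalues_nonneg⟩

theorem PosDef.exists_conjDiag {A : Matrix S S ℂ} (hA : A.PosDef) :
    ∃ (U : Matrix S S ℂ) (d : S → ℝ), Uᴴ * U = 1 ∧ A = conjDiag U d ∧ ∀ i, 0 < d i := by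
  obtain ⟨U, d, hU, h, rfl⟩ := SandwichedRenyi.exists_conjDiag hA.isHermitian
  exact ⟨U, _, hU, h, hA.eigenvalues_pos⟩

theorem dotProduct_conjDiag_mulVec (U : Matrix S S ℂ) (d : S → ℝ) (v : S → ℂ) :
    star v ⬝ᵥ (conjDiag U d *ᵥ v) = ((∑ i, d i * Complex.normSq ((Uᴴ *ᵥ v) i) : ℝ) : ℂ) := by
  have h : star v ⬝ᵥ (conjDiag U d *ᵥ v) =
      star (Uᴴ *ᵥ v) ⬝ᵥ (diagonal (fun i => (d i : ℂ)) *ᵥ (Uᴴ *ᵥ v)) := by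
    rw [star_mulVec, conjTranspose_conjTranspose, ← dotProduct_mulVec, mulVec_mulVec,
      mulVec_mulVec, conjDiag, Matrix.mul_assoc]
  rw [h, dotProduct]
  push_cast
  refine Finset.sum_congr rfl fun i _ => ?_
  rw [mulVec_diagonal, Complex.normSq_eq_conj_mul_self]
  simp only [Pi.star_apply, RCLike.star_def]
  ring

theorem conjDiag_posSemidef (U : Matrix S S ℂ) {d : S → ℝ} (hd : ∀ i, 0 ≤ d i) :
    (conjDiag U d).PosSemidef := by
  refine PosSemidef.of_dotProduct_mulVec_nonneg (conjDiag_isHermitian U d) fun v => ?_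
  rw [dotProduct_conjDiag_mulVec, Complex.zero_le_real]
  exact Finset.sum_nonneg fun i _ => mul_nonneg (hd i) (Complex.normSq_nonneg _)

theorem conjDiag_posDef {U : Matrix S S ℂ} (hU : Uᴴ * U = 1) {d : S → ℝ} (hd : ∀ i, 0 < d i) :
    (conjDiag U d).PosDef := by
  refine PosDef.of_dotProduct_mulVec_pos (conjDiag_isHermitian U d) fun v hv => ?_
  rw [dotProduct_conjDiag_mulVec, Complex.zero_lt_real]
  have hne : Uᴴ *ᵥ v ≠ 0 := fun h => hv <| by
    rw [← one_mulVec v, ← mul_eq_one_comm.mp hU, ← mulVec_mulVec, h, mulVec_zero]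
  obtain ⟨i, hi⟩ := Function.ne_iff.mp hne
  exact Finset.sum_pos' (fun j _ => mul_nonneg (hd j).le (Complex.normSq_nonneg _))
    ⟨i, Finset.mem_univ _, mul_pos (hd i) (Complex.normSq_pos.mpr hi)⟩

theorem conjDiag_inv {U : Matrix S S ℂ} (hU : Uᴴ * U = 1) {d : S → ℝ} (hd : ∀ i, d i ≠ 0) :
    (conjDiag U d)⁻¹ = conjDiag U (fun i => (d i)⁻¹) := by
  refine Matrix.inv_eq_right_inv ?_
  rw [conjDiag_mul hU, ← conjDiag_one hU]
  congr 1
  funext i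
  simp [hd i]

theorem trace_conjDiag {U : Matrix S S ℂ} (hU : Uᴴ * U = 1) (d : S → ℝ) :
    (conjDiag U d).trace = ((∑ i, d i : ℝ) : ℂ) := by
  rw [conjDiag, Matrix.trace_mul_comm, ← Matrix.mul_assoc, hU, Matrix.one_mul, trace_diagonal]
  simp

/-- Cyclicity moves the outer unitaries onto `K`, which leaves two diagonal matrices weighted by the
squared entries of `Uᴴ * K * W`. -/
theorem trace_conjDiag_mul_conjDiag (U W K : Matrix S S ℂ) (a b : S → ℝ) :
    (conjDiag U a * K * conjDiag W b * Kᴴ).trace =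
      ((∑ i, ∑ j, a i * b j * Complex.normSq ((Uᴴ * K * W) i j) : ℝ) : ℂ) := by
  have h : (conjDiag U a * K * conjDiag W b * Kᴴ).trace =
      (diagonal (fun i => (a i : ℂ)) * (Uᴴ * K * W) * diagonal (fun i => (b i : ℂ)) *
        (Uᴴ * K * W)ᴴ).trace := by
    simp only [conjDiag, conjTranspose_mul, conjTranspose_conjTranspose]
    rw [show U * diagonal (fun i => (a i : ℂ)) * Uᴴ * K * (W * diagonal (fun i => (b i : ℂ)) * Wᴴ) *
      Kᴴ = U * (diagonal (fun i => (a i : ℂ)) * Uᴴ * K * (W * diagonal (fun i => (b i : ℂ)) * Wᴴ) *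
      Kᴴ) by simp only [Matrix.mul_assoc], Matrix.trace_mul_comm]
    simp only [Matrix.mul_assoc]
  rw [h]
  push_cast
  refine Finset.sum_congr rfl fun i _ => ?_
  rw [diag_apply, mul_apply]
  refine Finset.sum_congr rfl fun j _ => ?_
  rw [mul_diagonal, diagonal_mul, conjTranspose_apply, ← Complex.mul_conj]
  simp only [RCLike.star_def]
  ring

theorem psdPow_conjDiag {U : Matrix S S ℂ} (hU : Uᴴ * U = 1) (d : S → ℝ) (s : ℝ) :
    psdPow (conjDiag U d) s = conjDiag U (fun i => d i ^ s) :=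
  cfc_conjDiag hU _ d

theorem psdPow_posSemidef {Y : Matrix S S ℂ} (hY : Y.PosSemidef) (s : ℝ) :
    (psdPow Y s).PosSemidef := by
  obtain ⟨U, d, hU, rfl, hd⟩ := PosSemidef.exists_conjDiag hY
  rw [psdPow_conjDiag hU]
  exact conjDiag_posSemidef _ fun i => Real.rpow_nonneg (hd i) _

theorem psdPow_half_mul_self {Y : Matrix S S ℂ} (hY : Y.PosSemidef) {s : ℝ} (hs : s ≠ 0) :
    psdPow Y (s / 2) * psdPow Y (s / 2) = psdPow Y s := by
  obtain ⟨U, d, hU, rfl, hd⟩ := PosSemidef.exists_conjDiag hY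
  rw [psdPow_conjDiag hU, psdPow_conjDiag hU, conjDiag_mul hU]
  congr 1
  funext i
  rcases (hd i).eq_or_lt with h | h
  · simp [← h, Real.zero_rpow hs, Real.zero_rpow (div_ne_zero hs two_ne_zero)]
  · simp [← Real.rpow_add h]

theorem psdPow_one {Y : Matrix S S ℂ} (hY : Y.PosSemidef) : psdPow Y 1 = Y := by
  obtain ⟨U, d, hU, rfl, hd⟩ := PosSemidef.exists_conjDiag hY
  simp [psdPow_conjDiag hU]

theorem sqrt_mul_sqrt {Y : Matrix S S ℂ} (hY : Y.PosSemidef) :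
    psdPow Y (1 / 2) * psdPow Y (1 / 2) = Y := by
  rw [psdPow_half_mul_self hY one_ne_zero, psdPow_one hY]

theorem conjDiag_kronecker (U W : Matrix S S ℂ) (a b : S → ℝ) :
    conjDiag U a ⊗ₖ conjDiag W b = conjDiag (U ⊗ₖ W) (fun p => a p.1 * b p.2) := by
  have h : (diagonal (fun i => (a i : ℂ))) ⊗ₖ (diagonal (fun i => (b i : ℂ))) =
      diagonal (fun p : S × S => ((a p.1 * b p.2 : ℝ) : ℂ)) := by
    rw [diagonal_kronecker_diagonal]
    simp
  unfold conjDiag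
  rw [mul_kronecker_mul, mul_kronecker_mul, h, conjTranspose_kronecker]

theorem conjDiag_transpose (W : Matrix S S ℂ) (b : S → ℝ) :
    (conjDiag W b).transpose = conjDiag (W.map star) b := by
  unfold conjDiag
  rw [transpose_mul, transpose_mul, diagonal_transpose, ← Matrix.mul_assoc]
  congr 1
  ext i j
  simp

/-- A matrix as a vector on the product index set. -/
def vec (K : Matrix S S ℂ) : S × S → ℂ := fun p => K p.1 p.2

omit [DecidableEq S] in
-- This identification turns statements about vectors of the doubled system into statements about
-- traces of matrices.
theorem kronecker_mulVec_vec (A C K : Matrix S S ℂ) :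
    (A ⊗ₖ C) *ᵥ vec K = vec (A * K * Cᵀ) := by
  funext p
  simp only [mulVec, dotProduct, vec, kroneckerMap_apply, Fintype.sum_prod_type, mul_apply,
    transpose_apply, Finset.sum_mul]
  rw [Finset.sum_comm]
  exact Finset.sum_congr rfl fun j _ => Finset.sum_congr rfl fun k _ => by ring

omit [DecidableEq S] in
theorem vec_dotProduct_vec (K L : Matrix S S ℂ) : star (vec K) ⬝ᵥ vec L = (Kᴴ * L).trace := by
  simp only [dotProduct, vec, Fintype.sum_prod_type, trace, diag_apply, mul_apply,
    conjTranspose_apply, Pi.star_apply]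
  exact Finset.sum_comm

theorem phiVec_eq (X : Matrix S S ℂ) : phiVec X = vec (psdPow X (1 / 2)) := by
  have h : maxEntangled S = vec (1 : Matrix S S ℂ) := by
    funext p
    simp [maxEntangled, vec, one_apply]
  rw [phiVec, h, kronecker_mulVec_vec]
  simp

theorem kronecker_isometry {U W : Matrix S S ℂ} (hU : Uᴴ * U = 1) (hW : Wᴴ * W = 1) :
    (U ⊗ₖ W)ᴴ * (U ⊗ₖ W) = 1 := by
  rw [conjTranspose_kronecker, ← mul_kronecker_mul, hU, hW, one_kronecker_one]

theorem map_star_isometry {W : Matrix S S ℂ} (hW : Wᴴ * W = 1) :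
    (W.map star)ᴴ * W.map star = 1 := by
  have h : (W.map star)ᴴ * W.map star = (Wᴴ * W)ᵀ := by
    rw [transpose_mul]
    ext i j
    simp [mul_apply]
  rw [h, hW, transpose_one]

theorem fDivAt_conjDiag (f : ℝ → ℝ) {X U W : Matrix S S ℂ} (hU : Uᴴ * U = 1) (hW : Wᴴ * W = 1)
    {t : S → ℝ} (ht : ∀ i, 0 < t i) (z : S → ℝ) :
    fDivAt f X (conjDiag W z) (conjDiag U t) =
      ∑ i, ∑ j, f ((t i)⁻¹ * z j) * Complex.normSq ((Uᴴ * psdPow X (1 / 2) * W) i j) := by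
  rw [fDivAt, conjDiag_inv hU fun i => (ht i).ne', conjDiag_transpose, conjDiag_kronecker,
    cfc_conjDiag (kronecker_isometry hU (map_star_isometry hW)), dotProduct_conjDiag_mulVec,
    Complex.ofReal_re, Fintype.sum_prod_type, conjTranspose_kronecker, phiVec_eq,
    kronecker_mulVec_vec]
  refine Finset.sum_congr rfl fun i _ => Finset.sum_congr rfl fun j _ => ?_
  have h : (W.map star)ᴴᵀ = W := by
    ext i j
    simp
  rw [vec, h]

/-- A power is multiplicative: (z/t)^p = t^{-p} z^p splits the double sum over eigenvalues into a
trace of four factors. -/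
theorem fDivAt_rpow {X Z τ : Matrix S S ℂ} (hX : X.PosSemidef) (hZ : Z.PosDef) (hτ : τ.PosDef)
    (p : ℝ) :
    fDivAt (fun x => x ^ p) X Z τ =
      (psdPow τ (-p) * psdPow X (1 / 2) * psdPow Z p * psdPow X (1 / 2)).trace.re := by
  have hK : (psdPow X (1 / 2))ᴴ = psdPow X (1 / 2) := (psdPow_posSemidef hX _).isHermitian
  obtain ⟨U, t, hU, rfl, ht⟩ := PosDef.exists_conjDiag hτ
  obtain ⟨W, z, hW, rfl, hz⟩ := PosDef.exists_conjDiag hZ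
  have h := trace_conjDiag_mul_conjDiag U W (psdPow X (1 / 2)) (fun i => t i ^ (-p))
    (fun i => z i ^ p)
  rw [hK] at h
  rw [fDivAt_conjDiag _ hU hW ht, psdPow_conjDiag hU, psdPow_conjDiag hW, h, Complex.ofReal_re]
  refine Finset.sum_congr rfl fun i _ => Finset.sum_congr rfl fun j _ => ?_
  rw [Real.mul_rpow (inv_nonneg.mpr (ht i).le) (hz j).le, Real.inv_rpow (ht i).le,
    Real.rpow_neg (ht i).le]

theorem fDivAt_neg (f : ℝ → ℝ) (X Z τ : Matrix S S ℂ) :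
    fDivAt (fun x => -f x) X Z τ = -fDivAt f X Z τ := by
  rw [fDivAt, fDivAt, cfc_neg, neg_mulVec, dotProduct_neg, Complex.neg_re]

end Spectral

/-! ### From resolvent inequalities to powers; operator anti-monotonicity. -/

section Resolvent

open Matrix

theorem sum_integral_eq {ι : Type*} [Fintype ι] {μ : MeasureTheory.Measure ℝ} {f : ℝ → ℝ}
    {G : ℝ → ℝ → ℝ}
    (hf : ∀ x : ℝ, 0 < x → MeasureTheory.IntegrableOn (G x) (Set.Ioi 0) μ ∧
      f x = ∫ t in Set.Ioi 0, G x t ∂μ)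
    (c : ι → ℝ) {x : ι → ℝ} (hx : ∀ i, 0 < x i) :
    MeasureTheory.IntegrableOn (fun t => ∑ i, c i * G (x i) t) (Set.Ioi 0) μ ∧
      ∑ i, c i * f (x i) = ∫ t in Set.Ioi 0, ∑ i, c i * G (x i) t ∂μ := by
  refine ⟨MeasureTheory.integrable_finsetSum _ fun i _ => (hf _ (hx i)).1.const_mul _, ?_⟩
  rw [MeasureTheory.integral_finsetSum _ fun i _ => (hf _ (hx i)).1.const_mul _]
  refine Finset.sum_congr rfl fun i _ => ?_
  rw [MeasureTheory.integral_const_mul, (hf _ (hx i)).2]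

/-- A comparison of weighted sums passes to integrals of the integrand. -/
theorem sum_integral_le_sum_integral {ι κ : Type*} [Fintype ι] [Fintype κ]
    {μ : MeasureTheory.Measure ℝ} {f : ℝ → ℝ} {G : ℝ → ℝ → ℝ}
    (hf : ∀ x : ℝ, 0 < x → MeasureTheory.IntegrableOn (G x) (Set.Ioi 0) μ ∧
      f x = ∫ t in Set.Ioi 0, G x t ∂μ)
    {c x : ι → ℝ} {d y : κ → ℝ} (hx : ∀ i, 0 < x i) (hy : ∀ k, 0 < y k)
    (h : ∀ t : ℝ, 0 < t → ∑ i, c i * G (x i) t ≤ ∑ k, d k * G (y k) t) :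
    ∑ i, c i * f (x i) ≤ ∑ k, d k * f (y k) := by
  rw [(sum_integral_eq hf c hx).2, (sum_integral_eq hf d hy).2]
  exact MeasureTheory.setIntegral_mono_on (sum_integral_eq hf c hx).1 (sum_integral_eq hf d hy).1 measurableSet_Ioi h

variable {ι κ : Type*} [Fintype ι] [Fintype κ] {c x : ι → ℝ} {d y : κ → ℝ}

/-- For -1 < p < 0 the power x^p is a positive superposition of the functions t^p (x+t)⁻¹, obtained
by dividing the integral representation of x^{p+1} by x. The endpoint p = -1 is the limit of the
resolvents as t decreases to 0. -/
theorem sum_rpow_le_of_resolvent_le (hx : ∀ i, 0 < x i) (hy : ∀ k, 0 < y k)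
    (h : ∀ t : ℝ, 0 < t → ∑ i, c i * (x i + t)⁻¹ ≤ ∑ k, d k * (y k + t)⁻¹) {p : ℝ}
    (hp : -1 ≤ p) (hp0 : p < 0) : ∑ i, c i * x i ^ p ≤ ∑ k, d k * y k ^ p := by
  rcases hp.eq_or_lt with rfl | hp
  · simp only [Real.rpow_neg_one]
    refine le_of_tendsto_of_tendsto (b := nhdsWithin (0 : ℝ) (Set.Ioi 0))
      (f := fun t => ∑ i, c i * (x i + t)⁻¹) (g := fun t => ∑ k, d k * (y k + t)⁻¹) ?_ ?_
      (Filter.eventually_of_mem self_mem_nhdsWithin h)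
    · refine tendsto_finsetSum _ fun i _ => ?_
      have hc : ContinuousAt (fun t : ℝ => c i * (x i + t)⁻¹) 0 := by
        have : x i + 0 ≠ 0 := by simpa using (hx i).ne'
        fun_prop (disch := assumption)
      simpa using hc.tendsto.mono_left nhdsWithin_le_nhds
    · refine tendsto_finsetSum _ fun i _ => ?_
      have hc : ContinuousAt (fun t : ℝ => d i * (y i + t)⁻¹) 0 := by
        have : y i + 0 ≠ 0 := by simpa using (hy i).ne'
        fun_prop (disch := assumption)
      simpa using hc.tendsto.mono_left nhdsWithin_le_nhds
  · obtain ⟨μ, hμ⟩ := Real.exists_measure_rpow_eq_integral_rpowIntegrand₀₁ (p := p + 1)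
      ⟨by linarith, by linarith⟩
    refine sum_integral_le_sum_integral (μ := μ) (f := fun x => x ^ p)
      (G := fun x t => x⁻¹ * Real.rpowIntegrand₀₁ (p + 1) t x) (fun x hx => ⟨?_, ?_⟩) hx hy ?_
    · exact (hμ x hx.le).1.const_mul _
    · rw [MeasureTheory.integral_const_mul, ← (hμ x hx.le).2, Real.rpow_add hx, Real.rpow_one]
      field_simp
    · intro t ht
      have hG : ∀ x : ℝ, 0 < x →
          x⁻¹ * Real.rpowIntegrand₀₁ (p + 1) t x = t ^ p * (x + t)⁻¹ := by
        intro x hx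
        rw [Real.rpowIntegrand₀₁, Real.rpow_add ht, Real.rpow_one]
        field_simp
        ring
      have hl : ∑ i, c i * (fun x t => x⁻¹ * Real.rpowIntegrand₀₁ (p + 1) t x) (x i) t =
          t ^ p * ∑ i, c i * (x i + t)⁻¹ := by
        rw [Finset.mul_sum]
        refine Finset.sum_congr rfl fun i _ => ?_
        simp only [hG _ (hx i)]
        ring
      have hr : ∑ i, d i * (fun x t => x⁻¹ * Real.rpowIntegrand₀₁ (p + 1) t x) (y i) t =
          t ^ p * ∑ i, d i * (y i + t)⁻¹ := by
        rw [Finset.mul_sum]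
        refine Finset.sum_congr rfl fun i _ => ?_
        simp only [hG _ (hy i)]
        ring
      rw [hl, hr]
      exact mul_le_mul_of_nonneg_left (h t ht) (Real.rpow_nonneg ht.le _)

theorem tendsto_resolvent_atTop {x : ℝ} (hx : 0 < x) :
    Filter.Tendsto (fun t : ℝ => t ^ 2 * (x + t)⁻¹ - t) Filter.atTop (nhds (-x)) := by
  have h1 : Filter.Tendsto (fun t : ℝ => -x + x ^ 2 * (x + t)⁻¹) Filter.atTop
      (nhds (-x + x ^ 2 * 0)) :=
    ((tendsto_inv_atTop_zero.comp (Filter.tendsto_atTop_add_const_left _ x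
      Filter.tendsto_id)).const_mul _).const_add _
  rw [mul_zero, add_zero] at h1
  refine h1.congr' ?_
  filter_upwards [Filter.eventually_gt_atTop 0] with t ht
  have : x + t ≠ 0 := by positivity
  field_simp
  ring

/-- For 0 < p < 1 the integrand of -x^p is t^p (x+t)⁻¹ minus a quantity independent of x, which
cancels because both sides have the same total weight. The endpoint p = 1 is the limit of t² (x+t)⁻¹
- t as t tends to infinity. -/
theorem sum_neg_rpow_le_of_resolvent_le (hx : ∀ i, 0 < x i) (hy : ∀ k, 0 < y k)
    (hcd : ∑ i, c i = ∑ k, d k)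
    (h : ∀ t : ℝ, 0 < t → ∑ i, c i * (x i + t)⁻¹ ≤ ∑ k, d k * (y k + t)⁻¹) {p : ℝ}
    (hp0 : 0 < p) (hp : p ≤ 1) : ∑ i, c i * -x i ^ p ≤ ∑ k, d k * -y k ^ p := by
  rcases hp.eq_or_lt with rfl | hp
  · simp only [Real.rpow_one]
    refine le_of_tendsto_of_tendsto (b := Filter.atTop)
      (f := fun t => ∑ i, c i * (t ^ 2 * (x i + t)⁻¹ - t))
      (g := fun t => ∑ k, d k * (t ^ 2 * (y k + t)⁻¹ - t))
      (tendsto_finsetSum _ fun i _ => (tendsto_resolvent_atTop (hx i)).const_mul _)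
      (tendsto_finsetSum _ fun i _ => (tendsto_resolvent_atTop (hy i)).const_mul _) ?_
    filter_upwards [Filter.eventually_gt_atTop 0] with t ht
    have h1 := mul_le_mul_of_nonneg_left (h t ht) (sq_nonneg t)
    simp only [mul_sub, Finset.sum_sub_distrib, ← Finset.sum_mul, hcd]
    rw [Finset.mul_sum, Finset.mul_sum] at h1
    simp only [mul_left_comm (t ^ 2)] at h1
    linarith
  · obtain ⟨μ, hμ⟩ := Real.exists_measure_rpow_eq_integral_rpowIntegrand₀₁ (p := p) ⟨hp0, hp⟩
    refine sum_integral_le_sum_integral (μ := μ) (f := fun x => -x ^ p)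
      (G := fun x t => -Real.rpowIntegrand₀₁ p t x) (fun x hx => ⟨?_, ?_⟩) hx hy ?_
    · exact (hμ x hx.le).1.neg
    · rw [MeasureTheory.integral_neg, ← (hμ x hx.le).2]
    · intro t ht
      have h1 := mul_le_mul_of_nonneg_left (h t ht) (Real.rpow_nonneg ht.le p)
      have hG : ∀ c x : ℝ, c * -Real.rpowIntegrand₀₁ p t x =
          t ^ p * (c * (x + t)⁻¹) - c * (t ^ p * t⁻¹) := by
        intro c x
        rw [Real.rpowIntegrand₀₁, add_comm t x]
        ring
      simp only [hG, Finset.sum_sub_distrib, ← Finset.sum_mul, hcd, ← Finset.mul_sum]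
      linarith

variable {m n : Type*} [Fintype m] [DecidableEq m] [Fintype n] [DecidableEq n]

/-- Complete the square: with ψ = A⁻¹φ, the difference of the two sides is ⟨u-ψ, A(u-ψ)⟩. Equality
holds at u = ψ. -/
theorem two_mul_re_sub_le {A : Matrix n n ℂ} (hA : A.PosDef) (φ u : n → ℂ) :
    2 * (star φ ⬝ᵥ u).re - (star u ⬝ᵥ (A *ᵥ u)).re ≤ (star φ ⬝ᵥ (A⁻¹ *ᵥ φ)).re := by
  have hu : IsUnit A.det := (Matrix.isUnit_iff_isUnit_det A).mp hA.isUnit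
  set ψ := A⁻¹ *ᵥ φ with hψ
  have hAψ : A *ᵥ ψ = φ := by
    rw [hψ, mulVec_mulVec, mul_nonsing_inv _ hu, one_mulVec]
  have h0 := hA.posSemidef.dotProduct_mulVec_nonneg (u - ψ)
  have h1 : star ψ ⬝ᵥ (A *ᵥ u) = star φ ⬝ᵥ u := by
    rw [← hAψ, star_mulVec A, hA.isHermitian.eq, dotProduct_mulVec]
  have h2 : (star u ⬝ᵥ φ).re = (star φ ⬝ᵥ u).re := by
    rw [star_dotProduct u φ]
    simp [RCLike.star_def]
  have h3 : star ψ ⬝ᵥ φ = star (star φ ⬝ᵥ ψ) := star_dotProduct ψ φ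
  rw [mulVec_sub, hAψ, star_sub, sub_dotProduct, dotProduct_sub, dotProduct_sub, h1, h3] at h0
  have h4 := (Complex.le_def.mp h0).1
  simp only [Complex.zero_re, Complex.sub_re, h2, RCLike.star_def, Complex.conj_re] at h4
  linarith

/-- Test the variational bound for A at u = V w, where w = A'⁻¹φ' attains equality in the bound for
A'. Linearity of V plays no role. -/
theorem resolvent_le {A : Matrix n n ℂ} {A' : Matrix m m ℂ} (hA : A.PosDef) (hA' : A'.PosDef)
    {φ : n → ℂ} {φ' : m → ℂ} (V : (m → ℂ) → (n → ℂ))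
    (hφ : ∀ w, (star φ' ⬝ᵥ w).re = (star φ ⬝ᵥ V w).re)
    (hV : ∀ w, (star (V w) ⬝ᵥ (A *ᵥ V w)).re ≤ (star w ⬝ᵥ (A' *ᵥ w)).re) :
    (star φ' ⬝ᵥ (A'⁻¹ *ᵥ φ')).re ≤ (star φ ⬝ᵥ (A⁻¹ *ᵥ φ)).re := by
  have hu : IsUnit A'.det := (Matrix.isUnit_iff_isUnit_det A').mp hA'.isUnit
  set w := A'⁻¹ *ᵥ φ' with hw
  have h1 : (star w ⬝ᵥ (A' *ᵥ w)).re = (star φ' ⬝ᵥ w).re := by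
    have h : A' *ᵥ w = φ' := by rw [hw, mulVec_mulVec, mul_nonsing_inv _ hu, one_mulVec]
    rw [h, star_dotProduct w φ']
    simp [RCLike.star_def]
  have h2 := two_mul_re_sub_le hA φ (V w)
  have h3 := hV w
  have h4 := hφ w
  linarith

theorem conjDiag_add_smul_one_inv {U : Matrix n n ℂ} {a : n → ℝ} (hU : Uᴴ * U = 1)
    (ha : ∀ i, 0 < a i) {t : ℝ} (ht : 0 < t) :
    (conjDiag U a + (t : ℂ) • 1)⁻¹ = conjDiag U (fun i => (a i + t)⁻¹) := by
  rw [← conjDiag_one hU, ← conjDiag_smul, ← conjDiag_add, conjDiag_inv hU]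
  · congr 1
    funext i
    simp
  · intro i
    simpa using (add_pos (ha i) ht).ne'

/-- Comparison of matrix elements of two positive definite matrices, one of which dominates a
compression of the other, for the functions `x ^ p` and `-x ^ p`. -/
theorem re_cfc_rpow_le {A : Matrix n n ℂ} {A' : Matrix m m ℂ} (hA : A.PosDef) (hA' : A'.PosDef)
    {φ : n → ℂ} {φ' : m → ℂ} (V : (m → ℂ) → (n → ℂ))
    (hφ : ∀ w, (star φ' ⬝ᵥ w).re = (star φ ⬝ᵥ V w).re)
    (hV : ∀ w, (star (V w) ⬝ᵥ (A *ᵥ V w)).re ≤ (star w ⬝ᵥ (A' *ᵥ w)).re)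
    (hV1 : ∀ w, (star (V w) ⬝ᵥ V w).re ≤ (star w ⬝ᵥ w).re) :
    (∀ p : ℝ, -1 ≤ p → p < 0 → (star φ' ⬝ᵥ (cfc (fun x : ℝ => x ^ p) A' *ᵥ φ')).re ≤
      (star φ ⬝ᵥ (cfc (fun x : ℝ => x ^ p) A *ᵥ φ)).re) ∧
    ((star φ' ⬝ᵥ φ').re = (star φ ⬝ᵥ φ).re →
      ∀ p : ℝ, 0 < p → p ≤ 1 → (star φ' ⬝ᵥ (cfc (fun x : ℝ => -x ^ p) A' *ᵥ φ')).re ≤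
      (star φ ⬝ᵥ (cfc (fun x : ℝ => -x ^ p) A *ᵥ φ)).re) := by
  -- The resolvent comparison is applied to the shifts by t; `hV` controls the unshifted parts and
  -- the contraction property `hV1` the multiples of t.
  have hres : ∀ t : ℝ, 0 < t → (star φ' ⬝ᵥ ((A' + (t : ℂ) • 1)⁻¹ *ᵥ φ')).re ≤
      (star φ ⬝ᵥ ((A + (t : ℂ) • 1)⁻¹ *ᵥ φ)).re := by
    intro t ht
    have ht' : (0 : ℂ) < t := Complex.zero_lt_real.mpr ht
    refine resolvent_le (hA.add (PosDef.one.smul ht')) (hA'.add (PosDef.one.smul ht')) V hφ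
      fun w => ?_
    simp only [add_mulVec, smul_mulVec, one_mulVec, dotProduct_add, dotProduct_smul,
      Complex.add_re, smul_eq_mul, Complex.re_ofReal_mul]
    exact add_le_add (hV w) (mul_le_mul_of_nonneg_left (hV1 w) ht.le)
  obtain ⟨U, a, hU, rfl, ha⟩ := PosDef.exists_conjDiag hA
  obtain ⟨U', a', hU', rfl, ha'⟩ := PosDef.exists_conjDiag hA'
  have h : ∀ t : ℝ, 0 < t → ∑ i, Complex.normSq ((U'ᴴ *ᵥ φ') i) * (a' i + t)⁻¹ ≤
      ∑ i, Complex.normSq ((Uᴴ *ᵥ φ) i) * (a i + t)⁻¹ := by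
    intro t ht
    have := hres t ht
    rw [conjDiag_add_smul_one_inv hU' ha' ht, conjDiag_add_smul_one_inv hU ha ht, dotProduct_conjDiag_mulVec, dotProduct_conjDiag_mulVec,
      Complex.ofReal_re, Complex.ofReal_re] at this
    simpa only [mul_comm] using this
  constructor
  · intro p hp hp0
    rw [cfc_conjDiag hU, cfc_conjDiag hU', dotProduct_conjDiag_mulVec, dotProduct_conjDiag_mulVec,
      Complex.ofReal_re, Complex.ofReal_re]
    simpa only [mul_comm] using sum_rpow_le_of_resolvent_le ha' ha h hp hp0
  · intro hnorm p hp0 hp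
    -- The squared norm of a vector is the total weight of its spectral expansion, so `hnorm`
    -- supplies the equality of total weights.
    have hn := dotProduct_conjDiag_mulVec U 1 φ
    have hn' := dotProduct_conjDiag_mulVec U' 1 φ'
    rw [conjDiag_one hU, one_mulVec] at hn
    rw [conjDiag_one hU', one_mulVec] at hn'
    rw [hn, hn', Complex.ofReal_re, Complex.ofReal_re] at hnorm
    simp only [Pi.one_apply, one_mul] at hnorm
    rw [cfc_conjDiag hU, cfc_conjDiag hU', dotProduct_conjDiag_mulVec, dotProduct_conjDiag_mulVec,
      Complex.ofReal_re, Complex.ofReal_re]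
    simpa only [mul_comm] using sum_neg_rpow_le_of_resolvent_le ha' ha hnorm h hp0 hp

theorem operatorAntitone_of_re_le {f : ℝ → ℝ}
    (hf : ∀ (k : ℕ) (P Q : Matrix (Fin k) (Fin k) ℂ), P.PosDef → Q.PosDef → (Q - P).PosSemidef →
      ∀ v, (star v ⬝ᵥ (cfc f Q *ᵥ v)).re ≤ (star v ⬝ᵥ (cfc f P *ᵥ v)).re) :
    OperatorAntitone f := by
  intro k P Q hP hQ hPQ
  have hh : (cfc f P - cfc f Q).IsHermitian :=
    IsHermitian.sub (cfc_predicate (R := ℝ) f P) (cfc_predicate (R := ℝ) f Q)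
  refine PosSemidef.of_dotProduct_mulVec_nonneg hh fun v => ?_
  have him := hh.im_star_dotProduct_mulVec_self v
  rw [Complex.le_def]
  refine ⟨?_, him.symm⟩
  rw [sub_mulVec, dotProduct_sub, Complex.sub_re, Complex.zero_re, sub_nonneg]
  exact hf k P Q hP hQ hPQ v

omit [DecidableEq n] in
theorem re_le_of_sub_posSemidef {P Q : Matrix n n ℂ} (h : (Q - P).PosSemidef) (w : n → ℂ) :
    (star w ⬝ᵥ (P *ᵥ w)).re ≤ (star w ⬝ᵥ (Q *ᵥ w)).re := by
  have := (Complex.le_def.mp (h.dotProduct_mulVec_nonneg w)).1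
  rw [sub_mulVec, dotProduct_sub, Complex.sub_re, Complex.zero_re] at this
  linarith

/-- The comparison theorem with V the identity and the same vector on both sides. -/
theorem operatorAntitone_rpow {p : ℝ} (hp : -1 ≤ p) (hp0 : p < 0) :
    OperatorAntitone (fun x => x ^ p) :=
  operatorAntitone_of_re_le fun _ _ _ hP hQ hPQ v =>
    (re_cfc_rpow_le hP hQ (φ := v) (φ' := v) id (fun _ => rfl) (re_le_of_sub_posSemidef hPQ)
      fun _ => le_rfl).1 p hp hp0

theorem operatorAntitone_neg_rpow {p : ℝ} (hp0 : 0 < p) (hp : p ≤ 1) :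
    OperatorAntitone (fun x => -x ^ p) :=
  operatorAntitone_of_re_le fun _ _ _ hP hQ hPQ v =>
    (re_cfc_rpow_le hP hQ (φ := v) (φ' := v) id (fun _ => rfl) (re_le_of_sub_posSemidef hPQ)
      fun _ => le_rfl).2 rfl p hp0 hp

end Resolvent

/-! ### Channels, 2-positivity of the adjoint, and the Petz-type map. -/

section Channel

open Matrix

variable {S B : Type*} [Fintype S] [DecidableEq S] [Fintype B] [DecidableEq B]

theorem trace_mul_nonneg {A C : Matrix S S ℂ} (hA : A.PosSemidef) (hC : C.PosSemidef) :
    0 ≤ (A * C).trace := by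
  have h := (hC.mul_mul_conjTranspose_same (psdPow A (1 / 2))).trace_nonneg
  rwa [(psdPow_posSemidef hA _).isHermitian.eq, Matrix.trace_mul_comm, ← Matrix.mul_assoc,
    sqrt_mul_sqrt hA] at h

theorem re_trace_mul_le {A C D : Matrix S S ℂ} (hCD : (D - C).PosSemidef) (hA : A.PosSemidef) :
    (C * A).trace.re ≤ (D * A).trace.re := by
  have h := (Complex.le_def.mp (trace_mul_nonneg hCD hA)).1
  rw [Matrix.sub_mul, trace_sub, Complex.sub_re, Complex.zero_re] at h
  linarith

/-- The adjoint of a linear map of matrices for the trace pairing. -/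
noncomputable def traceAdjoint (N : Matrix S S ℂ →ₗ[ℂ] Matrix B B ℂ) (M : Matrix B B ℂ) :
    Matrix S S ℂ :=
  fun i j => (N (single j i 1) * M).trace

omit [DecidableEq B] in
theorem trace_mul_traceAdjoint (N : Matrix S S ℂ →ₗ[ℂ] Matrix B B ℂ) (A : Matrix S S ℂ)
    (M : Matrix B B ℂ) : (A * traceAdjoint N M).trace = (N A * M).trace := by
  have h : ∀ i j, N (single i j (A i j)) = A i j • N (single i j (1 : ℂ)) := fun i j => by
    rw [← map_smul, smul_single, smul_eq_mul, mul_one]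
  conv_rhs => rw [matrix_eq_sum_single A]
  simp only [map_sum, h, Matrix.sum_mul, trace_sum, Matrix.smul_mul, trace_smul, smul_eq_mul]
  rfl

open scoped Matrix.Norms.L2Operator MatrixOrder CStarAlgebra in
-- Complete positivity enters only here, in the form of 2-positivity; the rest is a translation
-- between block matrices and 2 by 2 matrices over a C*-algebra.
theorem IsQuantumChannel.posSemidef_fromBlocks {N : Matrix S S ℂ →ₗ[ℂ] Matrix B B ℂ}
    (hN : IsQuantumChannel N) {Q : Matrix (S ⊕ S) (S ⊕ S) ℂ} (hQ : Q.PosSemidef) :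
    (fromBlocks (N Q.toBlocks₁₁) (N Q.toBlocks₁₂) (N Q.toBlocks₂₁)
      (N Q.toBlocks₂₂)).PosSemidef := by
  obtain ⟨Φ, hΦ⟩ := hN.completelyPositive
  set R := psdPow Q (1 / 2) with hR
  have hRQ : Rᴴ * R = Q := by
    rw [(psdPow_posSemidef hQ _).isHermitian.eq, sqrt_mul_sqrt hQ]
  let e : Fin 2 → S → S ⊕ S := ![Sum.inl, Sum.inr]
  let r : CStarMatrix (Fin 2) (Fin 2) (Matrix S S ℂ) := fun i j => R.submatrix (e i) (e j)
  have hr : ∀ i j, (star r * r) i j = Q.submatrix (e i) (e j) := by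
    intro i j
    rw [CStarMatrix.mul_apply, Fin.sum_univ_two, ← hRQ]
    ext k l
    rw [CStarMatrix.star_apply, CStarMatrix.star_apply, star_eq_conjTranspose,
      star_eq_conjTranspose]
    simp [r, e, mul_apply]
  have h := Φ.map_cstarMatrix_nonneg' 2 (star r * r) (star_mul_self_nonneg r)
  -- Nonnegative elements are sums of elements star y * y, and each of these is a Gram matrix in
  -- block form.
  have hM : ∀ M : CStarMatrix (Fin 2) (Fin 2) (Matrix B B ℂ), 0 ≤ M →
      (fromBlocks (M 0 0) (M 0 1) (M 1 0) (M 1 1)).PosSemidef := by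
    intro M hM
    rw [StarOrderedRing.nonneg_iff] at hM
    induction hM using AddSubmonoid.closure_induction with
    | mem M hM =>
      obtain ⟨y, rfl⟩ := hM
      have hy : ∀ i j, (star y * y) i j = (y 0 i)ᴴ * y 0 j + (y 1 i)ᴴ * y 1 j := by
        intro i j
        rw [CStarMatrix.mul_apply, Fin.sum_univ_two, CStarMatrix.star_apply,
          CStarMatrix.star_apply, star_eq_conjTranspose, star_eq_conjTranspose]
      have hfin : fromBlocks ((star y * y) 0 0) ((star y * y) 0 1) ((star y * y) 1 0)
          ((star y * y) 1 1) = (fromBlocks (y 0 0) (y 0 1) (y 1 0) (y 1 1))ᴴ *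
          fromBlocks (y 0 0) (y 0 1) (y 1 0) (y 1 1) := by
        rw [fromBlocks_conjTranspose, fromBlocks_multiply, hy, hy, hy, hy]
      change (fromBlocks ((star y * y) 0 0) ((star y * y) 0 1) ((star y * y) 1 0)
          ((star y * y) 1 1)).PosSemidef
      rw [hfin]
      exact posSemidef_conjTranspose_mul_self _
    | zero =>
      change (fromBlocks 0 0 0 0).PosSemidef
      rw [fromBlocks_zero]
      exact PosSemidef.zero
    | add M M' _ _ h h' =>
      have := h.add h'
      rw [fromBlocks_add] at this
      exact this
  have hfin := hM _ h
  have hent : ∀ i j, (star r * r).map Φ.toLinearMap i j = N (Q.submatrix (e i) (e j)) := by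
    intro i j
    rw [CStarMatrix.map_apply, hr]
    exact hΦ _
  rw [hent, hent, hent, hent] at hfin
  exact hfin

theorem IsQuantumChannel.map_posSemidef {N : Matrix S S ℂ →ₗ[ℂ] Matrix B B ℂ}
    (hN : IsQuantumChannel N) {X : Matrix S S ℂ} (hX : X.PosSemidef) : (N X).PosSemidef := by
  -- The input is the block matrix all of whose four blocks are X; a diagonal corner of its image is
  -- N X.
  have h := (hN.posSemidef_fromBlocks (hX.submatrix (Sum.elim id id : S ⊕ S → S))).submatrix
    (Sum.inl : B → B ⊕ B)
  exact h

/-- The matrix units (i,j) and (j,i) are the off-diagonal blocks of the rank-one projector onto the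
span of (e_i, e_j), up to scaling, and the image of that block matrix is Hermitian. -/
theorem IsQuantumChannel.map_single_conjTranspose {N : Matrix S S ℂ →ₗ[ℂ] Matrix B B ℂ}
    (hN : IsQuantumChannel N) (i j : S) : (N (single i j 1))ᴴ = N (single j i 1) := by
  let v : S ⊕ S → ℂ := Sum.elim (Pi.single i 1) (Pi.single j 1)
  have h := (hN.posSemidef_fromBlocks (posSemidef_vecMulVec_self_star v)).isHermitian
  have key : ∀ k l : S, (Matrix.of fun a b => (Pi.single k 1 : S → ℂ) a *
      star ((Pi.single l 1 : S → ℂ) b)) = single k l (1 : ℂ) := by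
    intro k l
    ext a b
    by_cases ha : k = a <;> by_cases hb : l = b <;>
      simp [Pi.single_apply, ha, hb, eq_comm (a := a), eq_comm (a := b)]
  have h12 : (vecMulVec v (star v)).toBlocks₁₂ = single i j 1 := key i j
  have h21 : (vecMulVec v (star v)).toBlocks₂₁ = single j i 1 := key j i
  rw [h12, h21, isHermitian_fromBlocks_iff] at h
  exact h.2.1

theorem IsQuantumChannel.traceAdjoint_conjTranspose {N : Matrix S S ℂ →ₗ[ℂ] Matrix B B ℂ}
    (hN : IsQuantumChannel N) (M : Matrix B B ℂ) :
    (traceAdjoint N M)ᴴ = traceAdjoint N Mᴴ := by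
  ext i j
  rw [conjTranspose_apply, traceAdjoint, traceAdjoint, ← trace_conjTranspose, conjTranspose_mul,
    hN.map_single_conjTranspose, Matrix.trace_mul_comm]

theorem IsQuantumChannel.traceAdjoint_one {N : Matrix S S ℂ →ₗ[ℂ] Matrix B B ℂ}
    (hN : IsQuantumChannel N) : traceAdjoint N 1 = 1 := by
  ext i j
  rw [traceAdjoint, Matrix.mul_one, hN.tracePreserving, one_apply]
  split_ifs with h
  · rw [h, trace_single_eq_same]
  · exact trace_single_eq_of_ne _ _ _ (Ne.symm h)

omit [DecidableEq S] in
theorem trace_fromBlocks' (P G H R : Matrix S S ℂ) :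
    (fromBlocks P G H R).trace = P.trace + R.trace := by
  simp [trace, Fintype.sum_sum_type]

/-- 2-positivity passes to the adjoint by duality: the quadratic form at v is the trace pairing of
the given block matrix with the blockwise image of v vᴴ, both positive semi-definite. -/
theorem IsQuantumChannel.traceAdjoint_fromBlocks {N : Matrix S S ℂ →ₗ[ℂ] Matrix B B ℂ}
    (hN : IsQuantumChannel N) {P G R : Matrix B B ℂ} (h : (fromBlocks P G Gᴴ R).PosSemidef) :
    (fromBlocks (traceAdjoint N P) (traceAdjoint N G) (traceAdjoint N G)ᴴ
      (traceAdjoint N R)).PosSemidef := by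
  obtain ⟨hP, -, -, hR⟩ := isHermitian_fromBlocks_iff.mp h.isHermitian
  refine PosSemidef.of_dotProduct_mulVec_nonneg ?_ fun v => ?_
  · refine IsHermitian.fromBlocks ?_ rfl ?_
    · rw [Matrix.IsHermitian, hN.traceAdjoint_conjTranspose, hP.eq]
    · rw [Matrix.IsHermitian, hN.traceAdjoint_conjTranspose, hR.eq]
  · set Q := vecMulVec v (star v) with hQ
    have hQp : Q.PosSemidef := posSemidef_vecMulVec_self_star v
    have h1 := trace_mul_nonneg (hN.posSemidef_fromBlocks hQp) h
    rw [fromBlocks_multiply, trace_fromBlocks', trace_add, trace_add] at h1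
    simp only [← trace_mul_traceAdjoint] at h1
    rw [hN.traceAdjoint_conjTranspose]
    have h2 : star v ⬝ᵥ (fromBlocks (traceAdjoint N P) (traceAdjoint N G) (traceAdjoint N Gᴴ)
        (traceAdjoint N R) *ᵥ v) = (Q * fromBlocks (traceAdjoint N P) (traceAdjoint N G)
        (traceAdjoint N Gᴴ) (traceAdjoint N R)).trace := by
      rw [hQ, Matrix.trace_mul_comm, mul_vecMulVec, trace_vecMulVec, dotProduct_comm]
    rw [h2, ← fromBlocks_toBlocks Q, fromBlocks_multiply, trace_fromBlocks', trace_add, trace_add]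
    exact h1

omit [DecidableEq S] in
theorem fromBlocks_zero_posSemidef {A : Matrix S S ℂ} (hA : A.PosSemidef) :
    (fromBlocks A 0 0 0 : Matrix (S ⊕ S) (S ⊕ S) ℂ).PosSemidef := by
  refine PosSemidef.of_dotProduct_mulVec_nonneg
    (IsHermitian.fromBlocks hA.isHermitian conjTranspose_zero isHermitian_zero) fun v => ?_
  have h := hA.dotProduct_mulVec_nonneg (v ∘ Sum.inl)
  simpa [fromBlocks_mulVec, dotProduct, Fintype.sum_sum_type] using h

theorem IsQuantumChannel.traceAdjoint_posSemidef {N : Matrix S S ℂ →ₗ[ℂ] Matrix B B ℂ}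
    (hN : IsQuantumChannel N) {P : Matrix B B ℂ} (hP : P.PosSemidef) :
    (traceAdjoint N P).PosSemidef := by
  have h := fromBlocks_zero_posSemidef hP
  rw [← conjTranspose_zero (m := B) (n := B)] at h
  nth_rw 1 [conjTranspose_zero] at h
  exact (hN.traceAdjoint_fromBlocks h).submatrix (Sum.inl : S → S ⊕ S)

theorem PosDef.schur {A G D : Matrix S S ℂ} (hA : A.PosDef)
    (h : (fromBlocks A G Gᴴ D).PosSemidef) : (D - Gᴴ * A⁻¹ * G).PosSemidef := by
  have := hA.isUnit.invertible
  exact (hA.fromBlocks₁₁ G D).mp h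

/-- The Schwarz inequality for the adjoint of a channel. -/
theorem IsQuantumChannel.schwarz {N : Matrix S S ℂ →ₗ[ℂ] Matrix B B ℂ}
    (hN : IsQuantumChannel N) (G : Matrix B B ℂ) :
    (traceAdjoint N (G * Gᴴ) - traceAdjoint N G * (traceAdjoint N G)ᴴ).PosSemidef := by
  -- This is the Gram matrix of the block row (1, Gᴴ). As N† is unital, the Schur complement of its
  -- image is the claim.
  have h : (fromBlocks 1 Gᴴ Gᴴᴴ (G * Gᴴ)).PosSemidef := by
    have := posSemidef_conjTranspose_mul_self (fromBlocks 1 Gᴴ 0 0 : Matrix (B ⊕ B) (B ⊕ B) ℂ)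
    simpa [fromBlocks_conjTranspose, fromBlocks_multiply] using this
  have h1 := hN.traceAdjoint_fromBlocks h
  rw [hN.traceAdjoint_one] at h1
  have h2 := PosDef.schur PosDef.one h1
  simpa [hN.traceAdjoint_conjTranspose] using h2

theorem psdPow_mul_psdPow {Y : Matrix S S ℂ} (hY : Y.PosSemidef) {r s q : ℝ}
    (h : ∀ x : ℝ, 0 ≤ x → x ^ r * x ^ s = x ^ q) : psdPow Y r * psdPow Y s = psdPow Y q := by
  obtain ⟨U, d, hU, rfl, hd⟩ := PosSemidef.exists_conjDiag hY
  rw [psdPow_conjDiag hU, psdPow_conjDiag hU, psdPow_conjDiag hU, conjDiag_mul hU]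
  congr 1
  funext i
  exact h _ (hd i)

/-- The Petz recovery type map `W ↦ √X N†(X'^{-1/2} W)` with `X' = N X`. -/
noncomputable def petzMap (N : Matrix S S ℂ →ₗ[ℂ] Matrix B B ℂ) (X : Matrix S S ℂ)
    (W : Matrix B B ℂ) : Matrix S S ℂ :=
  psdPow X (1 / 2) * traceAdjoint N (psdPow (N X) (-(1 / 2)) * W)

/-- Valid also for singular X, since 0 to a nonzero power is 0. -/
theorem mul_psdPow_neg_half {X : Matrix S S ℂ} (hX : X.PosSemidef) :
    X * psdPow X (-(1 / 2)) = psdPow X (1 / 2) := by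
  nth_rw 1 [← psdPow_one hX]
  refine psdPow_mul_psdPow hX fun x hx => ?_
  rcases hx.eq_or_lt with rfl | h
  · norm_num
  · rw [← Real.rpow_add h]
    norm_num

/-- The subtracted product is the projection onto the support of X. -/
theorem one_sub_supportProj_posSemidef {X : Matrix S S ℂ} (hX : X.PosSemidef) :
    (1 - psdPow X (-(1 / 2)) * X * psdPow X (-(1 / 2))).PosSemidef := by
  rw [Matrix.mul_assoc, mul_psdPow_neg_half hX]
  obtain ⟨U, d, hU, rfl, hd⟩ := PosSemidef.exists_conjDiag hX
  rw [psdPow_conjDiag hU, psdPow_conjDiag hU, conjDiag_mul hU, ← conjDiag_one hU, sub_eq_add_neg]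
  have h : -conjDiag U ((fun i => d i ^ (-(1 / 2) : ℝ)) * fun i => d i ^ (1 / 2 : ℝ)) =
      conjDiag U ((-1 : ℝ) • ((fun i => d i ^ (-(1 / 2) : ℝ)) * fun i => d i ^ (1 / 2 : ℝ))) := by
    rw [conjDiag_smul]
    simp
  rw [h, ← conjDiag_add]
  refine conjDiag_posSemidef U fun i => ?_
  rcases (hd i).eq_or_lt with h | h
  · simp [← h]
  · simp [← Real.rpow_add h]

variable {N : Matrix S S ℂ →ₗ[ℂ] Matrix B B ℂ} {X : Matrix S S ℂ}

/-- In vector form: the adjoint of the Petz-type map sends φ^X to φ^{N(X)}. -/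
theorem trace_sqrt_mul_petzMap (hN : IsQuantumChannel N) (hX : X.PosSemidef) (W : Matrix B B ℂ) :
    (psdPow X (1 / 2) * petzMap N X W).trace = (psdPow (N X) (1 / 2) * W).trace := by
  rw [petzMap, ← Matrix.mul_assoc, sqrt_mul_sqrt hX, trace_mul_traceAdjoint, ← Matrix.mul_assoc,
    mul_psdPow_neg_half (hN.map_posSemidef hX)]

/-- With J = N(X)^{-1/2}, the Schwarz inequality bounds the left side by Tr X N†(J W Wᴴ J) = Tr (J
N(X) J) W Wᴴ, and J N(X) J ≤ 1. -/
theorem petzMap_contraction (hN : IsQuantumChannel N) (hX : X.PosSemidef) (W : Matrix B B ℂ) :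
    ((petzMap N X W)ᴴ * petzMap N X W).trace.re ≤ (Wᴴ * W).trace.re := by
  have hX' := hN.map_posSemidef hX
  set J := psdPow (N X) (-(1 / 2)) with hJ
  have hJh : Jᴴ = J := (psdPow_posSemidef hX' _).isHermitian
  have hK : (psdPow X (1 / 2))ᴴ = psdPow X (1 / 2) := (psdPow_posSemidef hX _).isHermitian
  set T := traceAdjoint N (J * W) with hT
  have h1 : ((petzMap N X W)ᴴ * petzMap N X W).trace = (T * Tᴴ * X).trace := by
    have h : (petzMap N X W)ᴴ * petzMap N X W =
        Tᴴ * (psdPow X (1 / 2) * psdPow X (1 / 2)) * T := by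
      rw [petzMap, conjTranspose_mul, hK]
      simp only [← hJ, ← hT, Matrix.mul_assoc]
    rw [h, sqrt_mul_sqrt hX, Matrix.trace_mul_comm, ← Matrix.mul_assoc]
  have h2 : (traceAdjoint N (J * W * (J * W)ᴴ) * X).trace = (J * N X * J * (W * Wᴴ)).trace := by
    rw [Matrix.trace_mul_comm, trace_mul_traceAdjoint, conjTranspose_mul, hJh,
      show N X * (J * W * (Wᴴ * J)) = N X * J * (W * Wᴴ) * J by simp only [Matrix.mul_assoc],
      Matrix.trace_mul_comm _ J]
    simp only [Matrix.mul_assoc]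
  have h3 := re_trace_mul_le (hN.schwarz (J * W)) hX
  rw [h2, ← h1] at h3
  have h4 := re_trace_mul_le (one_sub_supportProj_posSemidef hX')
    (posSemidef_self_mul_conjTranspose W)
  rw [Matrix.one_mul, Matrix.trace_mul_comm W] at h4
  exact h3.trans h4

theorem fromBlocks_congr_posSemidef {P G R : Matrix S S ℂ} (h : (fromBlocks P G Gᴴ R).PosSemidef)
    (K L : Matrix S S ℂ) :
    (fromBlocks (Kᴴ * P * K) (Kᴴ * G * L) (Kᴴ * G * L)ᴴ (Lᴴ * R * L)).PosSemidef := by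
  have := h.conjTranspose_mul_mul_same (fromBlocks K 0 0 L)
  rw [fromBlocks_conjTranspose, fromBlocks_multiply, fromBlocks_multiply] at this
  simpa [Matrix.mul_assoc] using this

/-- This is Vᴴ (τ⁻¹ ⊗ Zᵀ) V ≤ τ'⁻¹ ⊗ Z'ᵀ in trace form. A positive block matrix with off-diagonal
entry V(W) is built from τ' and τ'⁻¹; its Schur complement gives V(W)ᴴ τ⁻¹ V(W) ≤ N†(Wᴴ τ'⁻¹ W),
which is then paired with Z, using N(Z) ≤ Z'. -/
theorem petzMap_modular (hN : IsQuantumChannel N) (hX : X.PosSemidef) {Z τ : Matrix S S ℂ}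
    {Z' τ' : Matrix B B ℂ} (hZ : Z.PosSemidef) (hτ : τ.PosDef) (hτ' : τ'.PosDef)
    (hZZ : (Z' - N Z).PosSemidef)
    (hττ : (τ - psdPow X (1 / 2) * traceAdjoint N (psdPow (N X) (-(1 / 2)) * τ' *
      psdPow (N X) (-(1 / 2))) * psdPow X (1 / 2)).PosSemidef) (W : Matrix B B ℂ) :
    ((petzMap N X W)ᴴ * (τ⁻¹ * petzMap N X W * Z)).trace.re ≤ (Wᴴ * (τ'⁻¹ * W * Z')).trace.re := by
  have hX' := hN.map_posSemidef hX
  set J := psdPow (N X) (-(1 / 2)) with hJ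
  have hJh : Jᴴ = J := (psdPow_posSemidef hX' _).isHermitian
  set K := psdPow X (1 / 2) with hKdef
  have hK : Kᴴ = K := (psdPow_posSemidef hX _).isHermitian
  have hdet : IsUnit τ'.det := (Matrix.isUnit_iff_isUnit_det τ').mp hτ'.isUnit
  have h1 : (fromBlocks (J * τ' * J) (J * W) (J * W)ᴴ (Wᴴ * τ'⁻¹ * W)).PosSemidef := by
    -- The Schur complement of this block matrix is zero.
    have h0 : (fromBlocks τ' 1 1ᴴ τ'⁻¹).PosSemidef := by
      have := hτ'.isUnit.invertible
      rw [hτ'.fromBlocks₁₁]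
      simpa using PosSemidef.zero
    have := fromBlocks_congr_posSemidef h0 J W
    rwa [hJh, Matrix.mul_one] at this
  have h2 := hN.traceAdjoint_fromBlocks h1
  have h3 : (fromBlocks (K * traceAdjoint N (J * τ' * J) * K) (petzMap N X W) (petzMap N X W)ᴴ
      (traceAdjoint N (Wᴴ * τ'⁻¹ * W))).PosSemidef := by
    have := fromBlocks_congr_posSemidef h2 K 1
    rwa [hK, Matrix.mul_one, conjTranspose_one, Matrix.mul_one, Matrix.one_mul] at this
  -- By `hττ` the upper left corner may be enlarged to τ, which is invertible.
  have h4 : (fromBlocks τ (petzMap N X W) (petzMap N X W)ᴴ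
      (traceAdjoint N (Wᴴ * τ'⁻¹ * W))).PosSemidef := by
    have h5 := fromBlocks_zero_posSemidef hττ
    have := h3.add h5
    simpa [fromBlocks_add] using this
  have h6 := re_trace_mul_le (PosDef.schur hτ h4) hZ
  have hpos : (Wᴴ * τ'⁻¹ * W).PosSemidef :=
    hτ'.inv.posSemidef.conjTranspose_mul_mul_same W
  have h7 := re_trace_mul_le hZZ hpos
  rw [Matrix.trace_mul_comm (traceAdjoint N _), trace_mul_traceAdjoint] at h6
  have h8 : (Wᴴ * (τ'⁻¹ * W * Z')).trace = (Z' * (Wᴴ * τ'⁻¹ * W)).trace := by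
    rw [Matrix.trace_mul_comm Z']
    simp only [Matrix.mul_assoc]
  rw [h8]
  refine le_trans (le_of_eq ?_) (h6.trans h7)
  simp only [Matrix.mul_assoc]

theorem fDivAt_map_le (hN : IsQuantumChannel N) (hX : X.PosSemidef) {Z τ : Matrix S S ℂ}
    {Z' τ' : Matrix B B ℂ} (hZ : Z.PosDef) (hτ : τ.PosDef) (hZ' : Z'.PosDef) (hτ' : τ'.PosDef)
    (hZZ : (Z' - N Z).PosSemidef)
    (hττ : (τ - psdPow X (1 / 2) * traceAdjoint N (psdPow (N X) (-(1 / 2)) * τ' *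
      psdPow (N X) (-(1 / 2))) * psdPow X (1 / 2)).PosSemidef) :
    (∀ p : ℝ, -1 ≤ p → p < 0 →
      fDivAt (fun x => x ^ p) (N X) Z' τ' ≤ fDivAt (fun x => x ^ p) X Z τ) ∧
    ∀ p : ℝ, 0 < p → p ≤ 1 →
      fDivAt (fun x => -x ^ p) (N X) Z' τ' ≤ fDivAt (fun x => -x ^ p) X Z τ := by
  have hX' := hN.map_posSemidef hX
  have hK : (psdPow X (1 / 2))ᴴ = psdPow X (1 / 2) := (psdPow_posSemidef hX _).isHermitian
  have hK' : (psdPow (N X) (1 / 2))ᴴ = psdPow (N X) (1 / 2) :=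
    (psdPow_posSemidef hX' _).isHermitian
  have hA : (τ⁻¹ ⊗ₖ Z.transpose).PosDef := hτ.inv.kronecker hZ.transpose
  have hA' : (τ'⁻¹ ⊗ₖ Z'.transpose).PosDef := hτ'.inv.kronecker hZ'.transpose
  have h := re_cfc_rpow_le hA hA' (φ := phiVec X) (φ' := phiVec (N X))
    (fun w => vec (petzMap N X (Matrix.of fun i j => w (i, j)))) ?_ ?_ ?_
  · refine ⟨h.1, h.2 ?_⟩
    rw [phiVec_eq, phiVec_eq, vec_dotProduct_vec, vec_dotProduct_vec, hK, hK', sqrt_mul_sqrt hX,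
      sqrt_mul_sqrt hX', hN.tracePreserving]
  · intro w
    change (star (phiVec (N X)) ⬝ᵥ vec (Matrix.of fun i j => w (i, j))).re = _
    rw [phiVec_eq, phiVec_eq, vec_dotProduct_vec, vec_dotProduct_vec, hK, hK',
      trace_sqrt_mul_petzMap hN hX]
  · intro w
    change _ ≤ (star (vec (Matrix.of fun i j => w (i, j))) ⬝ᵥ
      ((τ'⁻¹ ⊗ₖ Z'.transpose) *ᵥ vec (Matrix.of fun i j => w (i, j)))).re
    rw [kronecker_mulVec_vec, kronecker_mulVec_vec, vec_dotProduct_vec, vec_dotProduct_vec,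
      transpose_transpose, transpose_transpose]
    exact petzMap_modular hN hX hZ.posSemidef hτ hτ' hZZ hττ _
  · intro w
    change _ ≤ (star (vec (Matrix.of fun i j => w (i, j))) ⬝ᵥ vec (Matrix.of fun i j => w (i, j))).re
    rw [vec_dotProduct_vec, vec_dotProduct_vec]
    exact petzMap_contraction hN hX _

end Channel

/-! ### Data processing for the optimized divergence. -/

section DataProcessing

open Matrix

variable {S B : Type*} [Fintype S] [DecidableEq S] [Fintype B] [DecidableEq B]

theorem fDivAt_smul_left {f : ℝ → ℝ} {a c : ℝ} (hf : ∀ x : ℝ, 0 < x → f (a * x) = c * f x)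
    (X : Matrix S S ℂ) {Z τ : Matrix S S ℂ} (hZ : Z.PosDef) (hτ : τ.PosDef) :
    fDivAt f X ((a : ℂ) • Z) τ = c * fDivAt f X Z τ := by
  obtain ⟨U, t, hU, rfl, ht⟩ := PosDef.exists_conjDiag hτ
  obtain ⟨W, z, hW, rfl, hz⟩ := PosDef.exists_conjDiag hZ
  rw [← conjDiag_smul, fDivAt_conjDiag _ hU hW ht, fDivAt_conjDiag _ hU hW ht, Finset.mul_sum]
  refine Finset.sum_congr rfl fun i _ => ?_
  rw [Finset.mul_sum]
  refine Finset.sum_congr rfl fun j _ => ?_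
  rw [← mul_assoc, ← hf _ (mul_pos (inv_pos.mpr (ht i)) (hz j)), Pi.smul_apply, smul_eq_mul,
    mul_left_comm]

theorem fDivAt_smul_right (f : ℝ → ℝ) {a : ℝ} (ha : 0 < a)
    (X : Matrix S S ℂ) {Z τ : Matrix S S ℂ} (hZ : Z.PosDef) (hτ : τ.PosDef) :
    fDivAt f X Z ((a : ℂ) • τ) = fDivAt f X (((a⁻¹ : ℝ) : ℂ) • Z) τ := by
  obtain ⟨U, t, hU, rfl, ht⟩ := PosDef.exists_conjDiag hτ
  obtain ⟨W, z, hW, rfl, hz⟩ := PosDef.exists_conjDiag hZ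
  rw [← conjDiag_smul, ← conjDiag_smul, fDivAt_conjDiag _ hU hW ht,
    fDivAt_conjDiag _ hU hW fun i => by simpa using mul_pos ha (ht i)]
  refine Finset.sum_congr rfl fun i _ => Finset.sum_congr rfl fun j _ => ?_
  congr 2
  simp only [Pi.smul_apply, smul_eq_mul, mul_inv]
  ring

theorem add_smul_kerProj_posDef {Y : Matrix S S ℂ} (hY : Y.PosSemidef) {ε : ℝ} (hε : 0 < ε) :
    (Y + (ε : ℂ) • kerProj Y).PosDef := by
  obtain ⟨U, d, hU, rfl, hd⟩ := PosSemidef.exists_conjDiag hY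
  rw [kerProj, cfc_conjDiag hU, ← conjDiag_smul, ← conjDiag_add]
  refine conjDiag_posDef hU fun i => ?_
  rcases (hd i).eq_or_lt with h | h
  · simp [← h, hε]
  · simp [h.ne', h]

theorem kerProj_posSemidef {Y : Matrix S S ℂ} (hY : Y.PosSemidef) : (kerProj Y).PosSemidef := by
  obtain ⟨U, d, hU, rfl, hd⟩ := PosSemidef.exists_conjDiag hY
  rw [kerProj, cfc_conjDiag hU]
  refine conjDiag_posSemidef U fun i => ?_
  split_ifs <;> simp

theorem exists_smul_one_le {C : Matrix S S ℂ} (hC : C.PosDef) :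
    ∃ c : ℝ, 0 < c ∧ (C - (c : ℂ) • 1).PosSemidef := by
  obtain ⟨U, d, hU, rfl, hd⟩ := PosDef.exists_conjDiag hC
  have hpos : 0 < 1 + ∑ i, (d i)⁻¹ :=
    add_pos_of_pos_of_nonneg one_pos (Finset.sum_nonneg fun i _ => (inv_pos.mpr (hd i)).le)
  refine ⟨(1 + ∑ i, (d i)⁻¹)⁻¹, inv_pos.mpr hpos, ?_⟩
  rw [← conjDiag_one hU, sub_eq_add_neg, ← neg_smul, ← Complex.ofReal_neg, ← conjDiag_smul,
    ← conjDiag_add]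
  refine conjDiag_posSemidef U fun i => ?_
  have h1 : (d i)⁻¹ ≤ 1 + ∑ i, (d i)⁻¹ :=
    (Finset.single_le_sum (f := fun i => (d i)⁻¹) (fun i _ => (inv_pos.mpr (hd i)).le)
      (Finset.mem_univ i)).trans (by linarith)
  have h2 := inv_anti₀ (inv_pos.mpr (hd i)) h1
  rw [inv_inv] at h2
  simpa using h2

theorem exists_le_smul_one {D : Matrix S S ℂ} (hD : D.PosSemidef) :
    ∃ c : ℝ, 0 < c ∧ ((c : ℂ) • 1 - D).PosSemidef := by
  obtain ⟨U, d, hU, rfl, hd⟩ := PosSemidef.exists_conjDiag hD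
  refine ⟨1 + ∑ i, d i, add_pos_of_pos_of_nonneg one_pos (Finset.sum_nonneg fun i _ => hd i), ?_⟩
  have h : -conjDiag U d = conjDiag U ((-1 : ℝ) • d) := by
    rw [conjDiag_smul]
    simp
  rw [← conjDiag_one hU, sub_eq_add_neg, h, ← conjDiag_smul, ← conjDiag_add]
  refine conjDiag_posSemidef U fun i => ?_
  have h1 : d i ≤ ∑ i, d i := Finset.single_le_sum (fun i _ => hd i) (Finset.mem_univ i)
  simp
  linarith

/-- If C ≥ c and D ≤ e as multiples of the identity, then (c/e) D ≤ c ≤ C. -/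
theorem exists_sub_smul_posSemidef {C D : Matrix S S ℂ} (hC : C.PosDef) (hD : D.PosSemidef) :
    ∃ δ : ℝ, 0 < δ ∧ (C - (δ : ℂ) • D).PosSemidef := by
  obtain ⟨c, hc, h1⟩ := exists_smul_one_le hC
  obtain ⟨e, he, h2⟩ := exists_le_smul_one hD
  refine ⟨c / e, div_pos hc he, ?_⟩
  have h3 := h1.add (h2.smul (a := ((c / e : ℝ) : ℂ)) (Complex.zero_le_real.mpr (div_pos hc he).le))
  convert h3 using 1
  rw [smul_sub, smul_smul, ← Complex.ofReal_mul, div_mul_cancel₀ _ he.ne']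
  abel

theorem optFDiv_le_iff {f : ℝ → ℝ} {X Y : Matrix S S ℂ} {b : EReal} :
    optFDiv f X Y ≤ b ↔ ∀ τ : Matrix S S ℂ, τ.PosDef → τ.trace.re ≤ 1 → ∀ ε : ℝ, 0 < ε →
      (fDivAt f X (Y + (ε : ℂ) • kerProj Y) τ : EReal) ≤ b := by
  simp only [optFDiv, iSup_le_iff, and_imp]

theorem le_optFDiv (f : ℝ → ℝ) (X Y : Matrix S S ℂ) {τ : Matrix S S ℂ} (hτ : τ.PosDef)
    (hτ1 : τ.trace.re ≤ 1) {ε : ℝ} (hε : 0 < ε) :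
    (fDivAt f X (Y + (ε : ℂ) • kerProj Y) τ : EReal) ≤ optFDiv f X Y :=
  optFDiv_le_iff.mp le_rfl τ hτ hτ1 ε hε

/-- The data processing inequality for the optimized divergence of a homogeneous function that
satisfies it at each fixed pair of optimization parameters. -/
theorem optFDiv_map_le {N : Matrix S S ℂ →ₗ[ℂ] Matrix B B ℂ} (hN : IsQuantumChannel N)
    {X Y : Matrix S S ℂ} (hX : X.PosSemidef) (hY : Y.PosSemidef) {f : ℝ → ℝ} {p : ℝ}
    (hf : ∀ a x : ℝ, 0 < a → 0 < x → f (a * x) = a ^ p * f x)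
    (hle : ∀ (Z τ : Matrix S S ℂ) (Z' τ' : Matrix B B ℂ), Z.PosDef → τ.PosDef → Z'.PosDef →
      τ'.PosDef → (Z' - N Z).PosSemidef →
      (τ - psdPow X (1 / 2) * traceAdjoint N (psdPow (N X) (-(1 / 2)) * τ' *
        psdPow (N X) (-(1 / 2))) * psdPow X (1 / 2)).PosSemidef →
      fDivAt f (N X) Z' τ' ≤ fDivAt f X Z τ) :
    optFDiv f (N X) (N Y) ≤ optFDiv f X Y := by
  have hX' := hN.map_posSemidef hX
  have hY' := hN.map_posSemidef hY
  rw [optFDiv_le_iff]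
  intro τ' hτ' hτ'1 ε hε
  set Z' := N Y + (ε : ℂ) • kerProj (N Y) with hZ'def
  have hZ' : Z'.PosDef := add_smul_kerProj_posDef hY' hε
  set J := psdPow (N X) (-(1 / 2)) with hJ
  have hJh : Jᴴ = J := (psdPow_posSemidef hX' _).isHermitian
  have hK : (psdPow X (1 / 2))ᴴ = psdPow X (1 / 2) := (psdPow_posSemidef hX _).isHermitian
  set T := psdPow X (1 / 2) * traceAdjoint N (J * τ' * J) * psdPow X (1 / 2) with hT
  have hJτ : (J * τ' * J).PosSemidef := by
    have := hτ'.posSemidef.conjTranspose_mul_mul_same J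
    rwa [hJh] at this
  have hTp : T.PosSemidef := by
    have h2 := (hN.traceAdjoint_posSemidef hJτ).conjTranspose_mul_mul_same (psdPow X (1 / 2))
    rwa [hK] at h2
  -- The trace of T equals that of the support projection of N X times τ', which is at most Tr τ'.
  have hTtr : T.trace.re ≤ 1 := by
    have h1 : T.trace = (J * N X * J * τ').trace := by
      rw [hT, Matrix.trace_mul_comm, ← Matrix.mul_assoc, sqrt_mul_sqrt hX, trace_mul_traceAdjoint,
        show N X * (J * τ' * J) = N X * J * τ' * J by simp only [Matrix.mul_assoc],
        Matrix.trace_mul_comm _ J]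
      simp only [Matrix.mul_assoc]
    have h2 := re_trace_mul_le (one_sub_supportProj_posSemidef hX') hτ'.posSemidef
    rw [Matrix.one_mul] at h2
    rw [h1]
    exact h2.trans hτ'1
  -- T may be singular, and N(Y + δΠ) ≤ Z' may fail for every δ > 0. A factor κ > 1 leaves room for
  -- both: κ Z' replaces Z', and T + η is allowed trace κ. By homogeneity each relaxation costs one
  -- factor κ^p, which disappears as κ decreases to 1.
  have key : ∀ κ : ℝ, 1 < κ → ((κ ^ p * κ ^ p * fDivAt f (N X) Z' τ' : ℝ) : EReal) ≤
      optFDiv f X Y := by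
    intro κ hκ
    have hκ0 : 0 < κ := one_pos.trans hκ
    obtain ⟨δ, hδ, hδZ⟩ := exists_sub_smul_posSemidef
      (hZ'.smul (a := ((κ - 1 : ℝ) : ℂ)) (Complex.zero_lt_real.mpr (sub_pos.mpr hκ)))
      (hN.map_posSemidef (kerProj_posSemidef hY))
    set Z := Y + (δ : ℂ) • kerProj Y with hZdef
    have hZ : Z.PosDef := add_smul_kerProj_posDef hY hδ
    have hZZ : ((κ : ℂ) • Z' - N Z).PosSemidef := by
      have h1 := hδZ.add ((kerProj_posSemidef hY').smul (a := (ε : ℂ))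
        (Complex.zero_le_real.mpr hε.le))
      convert h1 using 1
      rw [hZdef, map_add, map_smul, Complex.ofReal_sub, sub_smul, Complex.ofReal_one, one_smul]
      nth_rw 3 [hZ'def]
      abel
    -- Chosen so that η times the dimension is at most κ - 1; the added 1 covers dimension zero.
    set η : ℝ := (κ - 1) / (Fintype.card S + 1) with hη
    have hη0 : 0 < η := div_pos (sub_pos.mpr hκ) (by positivity)
    have hηS : η * Fintype.card S ≤ κ - 1 := by
      rw [hη, div_mul_eq_mul_div, div_le_iff₀ (by positivity)]
      nlinarith
    have hτ0 : (T + (η : ℂ) • 1).PosDef :=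
      PosDef.posSemidef_add hTp (PosDef.one.smul (Complex.zero_lt_real.mpr hη0))
    set τ := ((κ⁻¹ : ℝ) : ℂ) • (T + (η : ℂ) • (1 : Matrix S S ℂ)) with hτdef
    have hτ : τ.PosDef := hτ0.smul (Complex.zero_lt_real.mpr (inv_pos.mpr hκ0))
    have hτtr : τ.trace.re ≤ 1 := by
      rw [hτdef, trace_smul, trace_add, trace_smul, trace_one, smul_eq_mul, Complex.re_ofReal_mul,
        Complex.add_re, smul_eq_mul, Complex.re_ofReal_mul, Complex.natCast_re,
        inv_mul_le_iff₀ hκ0]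
      linarith
    have hτκ : T + (η : ℂ) • (1 : Matrix S S ℂ) = (κ : ℂ) • τ := by
      rw [hτdef, smul_smul, ← Complex.ofReal_mul, mul_inv_cancel₀ hκ0.ne', Complex.ofReal_one,
        one_smul]
    have hmain := hle Z (T + (η : ℂ) • 1) ((κ : ℂ) • Z') τ' hZ hτ0
      (hZ'.smul (Complex.zero_lt_real.mpr hκ0)) hτ' hZZ (by
        rw [add_sub_cancel_left]
        exact PosSemidef.one.smul (Complex.zero_le_real.mpr hη0.le))
    rw [hτκ, fDivAt_smul_right f hκ0 X hZ hτ,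
      fDivAt_smul_left (fun x hx => hf κ x hκ0 hx) (N X) hZ' hτ',
      fDivAt_smul_left (fun x hx => hf κ⁻¹ x (inv_pos.mpr hκ0) hx) X hZ hτ,
      Real.inv_rpow hκ0.le] at hmain
    refine le_trans ?_ (le_optFDiv f X Y hτ hτtr hδ)
    rw [EReal.coe_le_coe_iff, mul_assoc]
    have hκp := Real.rpow_pos_of_pos hκ0 p
    rwa [← le_inv_mul_iff₀ hκp]
  have hlim : Filter.Tendsto
      (fun κ : ℝ => ((κ ^ p * κ ^ p * fDivAt f (N X) Z' τ' : ℝ) : EReal))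
      (nhdsWithin 1 (Set.Ioi 1)) (nhds (fDivAt f (N X) Z' τ' : EReal)) := by
    have hc : ContinuousAt (fun κ : ℝ => κ ^ p * κ ^ p * fDivAt f (N X) Z' τ') 1 := by
      have h1 : ContinuousAt (fun κ : ℝ => κ ^ p) 1 :=
        Real.continuousAt_rpow_const 1 p (Or.inl one_ne_zero)
      exact (h1.mul h1).mul continuousAt_const
    have h2 := (EReal.continuous_coe_iff.mpr continuous_id).continuousAt.tendsto.comp
      (hc.tendsto.mono_left (nhdsWithin_le_nhds (s := Set.Ioi 1)))
    simpa [Function.comp_def] using h2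
  exact le_of_tendsto hlim (Filter.eventually_of_mem self_mem_nhdsWithin key)

theorem optFDiv_rpow_map_le {N : Matrix S S ℂ →ₗ[ℂ] Matrix B B ℂ} (hN : IsQuantumChannel N)
    {X Y : Matrix S S ℂ} (hX : X.PosSemidef) (hY : Y.PosSemidef) {p : ℝ} (hp : -1 ≤ p)
    (hp0 : p < 0) :
    optFDiv (fun x => x ^ p) (N X) (N Y) ≤ optFDiv (fun x => x ^ p) X Y :=
  optFDiv_map_le hN hX hY (fun _ _ ha hx => Real.mul_rpow ha.le hx.le)
    fun _ _ _ _ hZ hτ hZ' hτ' h h' => (fDivAt_map_le hN hX hZ hτ hZ' hτ' h h').1 p hp hp0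

theorem optFDiv_neg_rpow_map_le {N : Matrix S S ℂ →ₗ[ℂ] Matrix B B ℂ} (hN : IsQuantumChannel N)
    {X Y : Matrix S S ℂ} (hX : X.PosSemidef) (hY : Y.PosSemidef) {p : ℝ} (hp0 : 0 < p)
    (hp : p ≤ 1) :
    optFDiv (fun x => -x ^ p) (N X) (N Y) ≤ optFDiv (fun x => -x ^ p) X Y :=
  optFDiv_map_le hN hX hY (p := p)
    (fun a x ha hx => by rw [Real.mul_rpow ha.le hx.le, mul_neg])
    fun _ _ _ _ hZ hτ hZ' hτ' h h' => (fDivAt_map_le hN hX hZ hτ hZ' hτ' h h').2 p hp0 hp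

end DataProcessing

/-! ### Variational formulas for the α-norms. -/

section Variational

open Matrix

variable {S : Type*} [Fintype S] [DecidableEq S]

theorem sum_weighted_holder {ι : Type*} [Fintype ι] {w a b : ι → ℝ} (hw : ∀ i, 0 ≤ w i)
    (ha : ∀ i, 0 ≤ a i) (hb : ∀ i, 0 ≤ b i) {θ : ℝ} (h0 : 0 < θ) (h1 : θ < 1) :
    ∑ i, w i * (a i ^ θ * b i ^ (1 - θ)) ≤ (∑ i, w i * a i) ^ θ * (∑ i, w i * b i) ^ (1 - θ) := by
  have h1' : 0 < 1 - θ := sub_pos.mpr h1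
  have hpq : (θ⁻¹).HolderConjugate (1 - θ)⁻¹ := .inv_one_sub_inv h0 h1
  have h := Real.inner_le_Lp_mul_Lq_of_nonneg Finset.univ hpq
    (f := fun i => (w i * a i) ^ θ) (g := fun i => (w i * b i) ^ (1 - θ))
    (fun i _ => Real.rpow_nonneg (mul_nonneg (hw i) (ha i)) _)
    (fun i _ => Real.rpow_nonneg (mul_nonneg (hw i) (hb i)) _)
  simp only [one_div, inv_inv] at h
  have e1 : ∀ i, ((w i * a i) ^ θ) ^ θ⁻¹ = w i * a i := fun i =>
    Real.rpow_rpow_inv (mul_nonneg (hw i) (ha i)) h0.ne'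
  have e2 : ∀ i, ((w i * b i) ^ (1 - θ)) ^ (1 - θ)⁻¹ = w i * b i := fun i =>
    Real.rpow_rpow_inv (mul_nonneg (hw i) (hb i)) h1'.ne'
  simp only [e1, e2] at h
  refine le_trans (le_of_eq (Finset.sum_congr rfl fun i _ => ?_)) h
  -- Splitting the weight between the two factors reduces the claim to the unweighted Hölder
  -- inequality with exponents 1/θ and 1/(1-θ).
  have hwi : w i = w i ^ θ * w i ^ (1 - θ) := by
    rw [← Real.rpow_add_of_nonneg (hw i) h0.le h1'.le]
    simp
  rw [Real.mul_rpow (hw i) (ha i), Real.mul_rpow (hw i) (hb i)]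
  nth_rw 1 [hwi]
  ring

section Overlap

variable {U V : Matrix S S ℂ}

/-- The matrix of squared overlaps of two orthonormal bases is doubly stochastic, as the rows and
columns of a unitary are unit vectors. -/
theorem sum_normSq_row (hU : Uᴴ * U = 1) (hV : Vᴴ * V = 1) (i : S) :
    ∑ j, Complex.normSq ((Uᴴ * V) i j) = 1 := by
  have h : (Uᴴ * V) * (Uᴴ * V)ᴴ = 1 := by
    rw [conjTranspose_mul, conjTranspose_conjTranspose, Matrix.mul_assoc, ← Matrix.mul_assoc V,
      mul_eq_one_comm.mp hV, Matrix.one_mul, hU]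
  have h1 := congrFun (congrFun h i) i
  rw [mul_apply, one_apply_eq] at h1
  have h2 : ((∑ j, Complex.normSq ((Uᴴ * V) i j) : ℝ) : ℂ) = 1 := by
    rw [← h1]
    push_cast
    refine Finset.sum_congr rfl fun j _ => ?_
    rw [conjTranspose_apply, ← Complex.mul_conj]
    rfl
  exact_mod_cast h2

theorem sum_normSq_col (hU : Uᴴ * U = 1) (hV : Vᴴ * V = 1) (j : S) :
    ∑ i, Complex.normSq ((Uᴴ * V) i j) = 1 := by
  have h := sum_normSq_row hV hU j
  rw [← h]
  refine Finset.sum_congr rfl fun i _ => ?_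
  have h1 : (Vᴴ * U) = (Uᴴ * V)ᴴ := by simp
  rw [h1, conjTranspose_apply, RCLike.star_def, Complex.normSq_conj]

theorem sum_overlap_left (hU : Uᴴ * U = 1) (hV : Vᴴ * V = 1) (a : S → ℝ) :
    ∑ k : S × S, Complex.normSq ((Uᴴ * V) k.1 k.2) * a k.1 = ∑ i, a i := by
  rw [Fintype.sum_prod_type]
  refine Finset.sum_congr rfl fun i _ => ?_
  change ∑ y, Complex.normSq ((Uᴴ * V) i y) * a i = a i
  rw [← Finset.sum_mul, sum_normSq_row hU hV, one_mul]

theorem sum_overlap_right (hU : Uᴴ * U = 1) (hV : Vᴴ * V = 1) (a : S → ℝ) :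
    ∑ k : S × S, Complex.normSq ((Uᴴ * V) k.1 k.2) * a k.2 = ∑ i, a i := by
  rw [Fintype.sum_prod_type_right]
  refine Finset.sum_congr rfl fun i _ => ?_
  change ∑ y, Complex.normSq ((Uᴴ * V) y i) * a i = a i
  rw [← Finset.sum_mul, sum_normSq_col hU hV, one_mul]

theorem re_trace_conjDiag_mul (U V : Matrix S S ℂ) (a b : S → ℝ) :
    (conjDiag U a * conjDiag V b).trace.re =
      ∑ k : S × S, Complex.normSq ((Uᴴ * V) k.1 k.2) * (a k.1 * b k.2) := by
  have h := trace_conjDiag_mul_conjDiag U V 1 a b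
  simp only [Matrix.mul_one, conjTranspose_one] at h
  rw [h, Complex.ofReal_re, Fintype.sum_prod_type]
  exact Finset.sum_congr rfl fun i _ => Finset.sum_congr rfl fun j _ => mul_comm _ _

end Overlap

/-- `(Tr (M ^ (1 / (1 + p)))) ^ (1 + p)`, the norm `‖M‖_α` for `(1 - α) / α = p`. -/
noncomputable def powNorm (p : ℝ) (M : Matrix S S ℂ) : ℝ :=
  (psdPow M (1 + p)⁻¹).trace.re ^ (1 + p)

theorem powNorm_conjDiag {V : Matrix S S ℂ} (hV : Vᴴ * V = 1) (m : S → ℝ) (p : ℝ) :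
    powNorm p (conjDiag V m) = (∑ j, m j ^ (1 + p)⁻¹) ^ (1 + p) := by
  rw [powNorm, psdPow_conjDiag hV, trace_conjDiag hV, Complex.ofReal_re]

/-- Hölder with θ = -p on the overlap weights, whose marginals are uniform, bounds the trace by (Tr
τ)^{-p} ‖M‖_α, and Tr τ ≤ 1. -/
theorem re_trace_rpow_mul_le_powNorm {M τ : Matrix S S ℂ} (hM : M.PosSemidef) (hτ : τ.PosDef)
    (hτ1 : τ.trace.re ≤ 1) {p : ℝ} (hp : -1 < p) (hp0 : p < 0) :
    (psdPow τ (-p) * M).trace.re ≤ powNorm p M := by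
  obtain ⟨V, m, hV, rfl, hm⟩ := PosSemidef.exists_conjDiag hM
  obtain ⟨U, t, hU, rfl, ht⟩ := PosDef.exists_conjDiag hτ
  rw [trace_conjDiag hU, Complex.ofReal_re] at hτ1
  have hp1 : 0 < 1 + p := by linarith
  rw [psdPow_conjDiag hU, re_trace_conjDiag_mul, powNorm_conjDiag hV]
  have h := sum_weighted_holder (ι := S × S)
    (w := fun k => Complex.normSq ((Uᴴ * V) k.1 k.2)) (a := fun k => t k.1)
    (b := fun k => m k.2 ^ (1 + p)⁻¹) (fun _ => Complex.normSq_nonneg _) (fun k => (ht k.1).le)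
    (fun k => Real.rpow_nonneg (hm k.2) _) (θ := -p) (by linarith) (by linarith)
  rw [sum_overlap_left hU hV t, sum_overlap_right hU hV fun j => m j ^ (1 + p)⁻¹,
    sub_neg_eq_add] at h
  have e : ∀ k : S × S, (m k.2 ^ (1 + p)⁻¹) ^ (1 + p) = m k.2 := fun k =>
    Real.rpow_inv_rpow (hm k.2) hp1.ne'
  simp only [e] at h
  refine h.trans ?_
  have h1 : (∑ i, t i) ^ (-p) ≤ 1 :=
    Real.rpow_le_one (Finset.sum_nonneg fun i _ => (ht i).le) hτ1 (by linarith)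
  exact mul_le_of_le_one_left (Real.rpow_nonneg
    (Finset.sum_nonneg fun j _ => Real.rpow_nonneg (hm j) _) _) h1

/-- Reverse Hölder: with α = 1/(1+p) one has pα = 1-α, so m^α = (t^{-p} m)^α t^{1-α}. Ordinary
Hölder for this product, followed by the power 1+p, gives the bound. -/
theorem powNorm_le_re_trace_rpow_mul {M τ : Matrix S S ℂ} (hM : M.PosSemidef) (hτ : τ.PosDef)
    (hτ1 : τ.trace.re ≤ 1) {p : ℝ} (hp0 : 0 < p) :
    powNorm p M ≤ (psdPow τ (-p) * M).trace.re := by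
  obtain ⟨V, m, hV, rfl, hm⟩ := PosSemidef.exists_conjDiag hM
  obtain ⟨U, t, hU, rfl, ht⟩ := PosDef.exists_conjDiag hτ
  rw [trace_conjDiag hU, Complex.ofReal_re] at hτ1
  have hp1 : 0 < 1 + p := by linarith
  have hα : 0 < (1 + p)⁻¹ := inv_pos.mpr hp1
  have hα1 : (1 + p)⁻¹ < 1 := inv_lt_one_of_one_lt₀ (by linarith)
  have hpα : 1 - (1 + p)⁻¹ = p * (1 + p)⁻¹ := by
    field_simp
    ring
  rw [psdPow_conjDiag hU, re_trace_conjDiag_mul, powNorm_conjDiag hV]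
  have hnn : ∀ k : S × S, 0 ≤ t k.1 ^ (-p) * m k.2 := fun k =>
    mul_nonneg (Real.rpow_nonneg (ht k.1).le _) (hm k.2)
  have h := sum_weighted_holder (ι := S × S)
    (w := fun k => Complex.normSq ((Uᴴ * V) k.1 k.2)) (a := fun k => t k.1 ^ (-p) * m k.2)
    (b := fun k => t k.1) (fun _ => Complex.normSq_nonneg _) hnn (fun k => (ht k.1).le) hα hα1
  have e : ∀ k : S × S, (t k.1 ^ (-p) * m k.2) ^ (1 + p)⁻¹ * t k.1 ^ (1 - (1 + p)⁻¹) =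
      m k.2 ^ (1 + p)⁻¹ := by
    intro k
    rw [Real.mul_rpow (Real.rpow_nonneg (ht k.1).le _) (hm k.2), ← Real.rpow_mul (ht k.1).le,
      mul_right_comm, ← Real.rpow_add (ht k.1), hpα]
    simp
  simp only [e] at h
  rw [sum_overlap_left hU hV t, sum_overlap_right hU hV fun j => m j ^ (1 + p)⁻¹] at h
  have hs : 0 ≤ ∑ k : S × S, Complex.normSq ((Uᴴ * V) k.1 k.2) * (t k.1 ^ (-p) * m k.2) :=
    Finset.sum_nonneg fun k _ => mul_nonneg (Complex.normSq_nonneg _) (hnn k)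
  have h1 : (∑ i, t i) ^ (1 - (1 + p)⁻¹) ≤ 1 :=
    Real.rpow_le_one (Finset.sum_nonneg fun i _ => (ht i).le) hτ1 (by linarith)
  have h2 := h.trans (mul_le_of_le_one_right (Real.rpow_nonneg hs _) h1)
  have h3 := Real.rpow_le_rpow (Finset.sum_nonneg fun j _ => Real.rpow_nonneg (hm j) _) h2 hp1.le
  rwa [Real.rpow_inv_rpow hs hp1.ne'] at h3

/-- Density matrices commuting with `M` and built from a limit of positive weights. -/
theorem exists_posDef_of_tendsto {V : Matrix S S ℂ} (hV : Vᴴ * V = 1) (m : S → ℝ) {p L : ℝ}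
    {g : ℝ → S → ℝ} (hg : ∀ η : ℝ, 0 < η → ∀ j, 0 < g η j)
    (hL : Filter.Tendsto (fun η => ∑ j, (g η j / ∑ i, g η i) ^ (-p) * m j)
      (nhdsWithin 0 (Set.Ioi 0)) (nhds L)) {δ : ℝ} (hδ : 0 < δ) :
    ∃ τ : Matrix S S ℂ, τ.PosDef ∧ τ.trace.re ≤ 1 ∧
      |(psdPow τ (-p) * conjDiag V m).trace.re - L| < δ := by
  have h1 := (Metric.tendsto_nhds.mp hL δ hδ).and self_mem_nhdsWithin
  obtain ⟨η, hη, hη0⟩ := h1.exists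
  refine ⟨conjDiag V (fun j => g η j / ∑ i, g η i), ?_, ?_, ?_⟩
  · refine conjDiag_posDef hV fun j => div_pos (hg η hη0 j) ?_
    exact Finset.sum_pos (fun i _ => hg η hη0 i) ⟨j, Finset.mem_univ j⟩
  · rw [trace_conjDiag hV, Complex.ofReal_re, ← Finset.sum_div]
    exact div_self_le_one _
  · rw [psdPow_conjDiag hV, conjDiag_mul hV, trace_conjDiag hV, Complex.ofReal_re]
    exact hη

/-- The equality case of Hölder is τ = M^α / Tr M^α. It may be singular, so η is added to each
eigenvalue before normalising and then sent to 0. -/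
theorem exists_posDef_powNorm {M : Matrix S S ℂ} (hM : M.PosSemidef) {p : ℝ} (hp : -1 < p)
    {δ : ℝ} (hδ : 0 < δ) :
    ∃ τ : Matrix S S ℂ, τ.PosDef ∧ τ.trace.re ≤ 1 ∧
      |(psdPow τ (-p) * M).trace.re - powNorm p M| < δ := by
  obtain ⟨V, m, hV, rfl, hm⟩ := PosSemidef.exists_conjDiag hM
  have hp1 : 0 < 1 + p := by linarith
  set α := (1 + p)⁻¹ with hα
  have hα0 : 0 < α := inv_pos.mpr hp1
  set A := ∑ j, m j ^ α with hA
  have hA0 : 0 ≤ A := Finset.sum_nonneg fun j _ => Real.rpow_nonneg (hm j) _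
  refine exists_posDef_of_tendsto hV m (g := fun η j => m j ^ α + η)
    (fun η hη j => add_pos_of_nonneg_of_pos (Real.rpow_nonneg (hm j) _) hη) ?_ hδ
  rw [powNorm_conjDiag hV, ← hα, ← hA]
  rcases hA0.eq_or_lt with hA0 | hA0
  · have hm0 : ∀ j, m j = 0 := by
      intro j
      have := (Finset.sum_eq_zero_iff_of_nonneg fun j _ => Real.rpow_nonneg (hm j) α).mp
        hA0.symm j (Finset.mem_univ j)
      exact (Real.rpow_eq_zero (hm j) hα0.ne').mp this
    simp [hm0, ← hA0, Real.zero_rpow hp1.ne']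
  -- Zero eigenvalues are split off: their weights tend to 0, where the power -p is discontinuous
  -- for p > 0, but the factor m j = 0 removes these terms for every η > 0.
  · have hval : A ^ (1 + p) = ∑ j, (if m j = 0 then 0 else (m j ^ α / A) ^ (-p) * m j) := by
      rw [Real.rpow_add hA0, Real.rpow_one]
      nth_rw 1 [hA]
      rw [Finset.sum_mul]
      refine Finset.sum_congr rfl fun j _ => ?_
      split_ifs with h
      · rw [h, Real.zero_rpow hα0.ne', zero_mul]
      · have hmj : 0 < m j := lt_of_le_of_ne (hm j) (Ne.symm h)
        rw [Real.div_rpow (Real.rpow_nonneg (hm j) _) hA0.le, ← Real.rpow_mul (hm j),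
          Real.rpow_neg hA0.le, div_inv_eq_mul, mul_right_comm]
        congr 1
        nth_rw 3 [← Real.rpow_one (m j)]
        rw [← Real.rpow_add hmj]
        congr 1
        rw [hα]
        field_simp
        ring
    rw [hval]
    refine tendsto_finsetSum _ fun j _ => ?_
    split_ifs with h
    · simp [h]
    · have hmj : 0 < m j := lt_of_le_of_ne (hm j) (Ne.symm h)
      have hmα : 0 < m j ^ α := Real.rpow_pos_of_pos hmj _
      refine Filter.Tendsto.mul_const _ ?_
      have hs : Filter.Tendsto (fun η : ℝ => ∑ i, (m i ^ α + η)) (nhdsWithin 0 (Set.Ioi 0))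
          (nhds A) := by
        have hc : ContinuousAt (fun η : ℝ => ∑ i, (m i ^ α + η)) 0 := by fun_prop
        have := hc.tendsto.mono_left (nhdsWithin_le_nhds (s := Set.Ioi 0))
        simpa [hA] using this
      have hn : Filter.Tendsto (fun η : ℝ => m j ^ α + η) (nhdsWithin 0 (Set.Ioi 0))
          (nhds (m j ^ α)) := by
        have hc : ContinuousAt (fun η : ℝ => m j ^ α + η) 0 := by fun_prop
        have := hc.tendsto.mono_left (nhdsWithin_le_nhds (s := Set.Ioi 0))
        simpa using this
      exact (hn.div hs hA0.ne').rpow_const (Or.inl (div_pos hmα hA0).ne')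

/-- The operator norm on the Euclidean space. -/
noncomputable def euclNorm (M : Matrix S S ℂ) : ℝ := ‖toEuclideanCLM (n := S) (𝕜 := ℂ) M‖

open scoped Matrix.Norms.L2Operator in
theorem euclNorm_conjDiag {V : Matrix S S ℂ} (hV : Vᴴ * V = 1) (m : S → ℝ) :
    euclNorm (conjDiag V m) = ‖m‖ := by
  have hVu : V ∈ unitary (Matrix S S ℂ) := ⟨hV, mul_eq_one_comm.mp hV⟩
  have hVs : Vᴴ ∈ unitary (Matrix S S ℂ) := Unitary.star_mem hVu
  have h : ‖conjDiag V m‖ = ‖m‖ := by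
    rw [conjDiag, CStarRing.norm_mul_mem_unitary _ hVs, CStarRing.norm_mem_unitary_mul _ hVu,
      l2_opNorm_diagonal]
    simp only [Pi.norm_def, nnnorm]
    congr 2
    funext i
    simp
  exact h

theorem re_trace_mul_le_euclNorm {M τ : Matrix S S ℂ} (hM : M.PosSemidef) (hτ : τ.PosDef)
    (hτ1 : τ.trace.re ≤ 1) : (psdPow τ (-(-1)) * M).trace.re ≤ euclNorm M := by
  obtain ⟨V, m, hV, rfl, hm⟩ := PosSemidef.exists_conjDiag hM
  obtain ⟨U, t, hU, rfl, ht⟩ := PosDef.exists_conjDiag hτ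
  rw [trace_conjDiag hU, Complex.ofReal_re] at hτ1
  rw [psdPow_conjDiag hU, re_trace_conjDiag_mul, euclNorm_conjDiag hV]
  have h : ∑ k : S × S, Complex.normSq ((Uᴴ * V) k.1 k.2) * (t k.1 ^ (-(-1) : ℝ) * m k.2) ≤
      ∑ k : S × S, Complex.normSq ((Uᴴ * V) k.1 k.2) * (t k.1 * ‖m‖) := by
    refine Finset.sum_le_sum fun k _ => mul_le_mul_of_nonneg_left ?_ (Complex.normSq_nonneg _)
    rw [neg_neg, Real.rpow_one]
    exact mul_le_mul_of_nonneg_left ((le_abs_self _).trans (norm_le_pi_norm m k.2)) (ht k.1).le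
  rw [sum_overlap_left hU hV fun i => t i * ‖m‖, ← Finset.sum_mul] at h
  exact h.trans (mul_le_of_le_one_left (norm_nonneg _) hτ1)

theorem exists_posDef_euclNorm {M : Matrix S S ℂ} (hM : M.PosSemidef) {δ : ℝ} (hδ : 0 < δ) :
    ∃ τ : Matrix S S ℂ, τ.PosDef ∧ τ.trace.re ≤ 1 ∧
      |(psdPow τ (-(-1)) * M).trace.re - euclNorm M| < δ := by
  obtain ⟨V, m, hV, rfl, hm⟩ := PosSemidef.exists_conjDiag hM
  rw [euclNorm_conjDiag hV]
  rcases isEmpty_or_nonempty S with hS | hS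
  -- In dimension zero there is no largest eigenvalue, but the identity has trace 0.
  · refine ⟨1, PosDef.one, by simp, ?_⟩
    simpa [trace, Pi.norm_def] using hδ
  obtain ⟨j₀, hj₀⟩ := Finite.exists_max m
  have hnorm : ‖m‖ = m j₀ := by
    refine le_antisymm ((pi_norm_le_iff_of_nonneg (hm j₀)).mpr fun j => ?_)
      ((le_abs_self _).trans (norm_le_pi_norm m j₀))
    rw [Real.norm_of_nonneg (hm j)]
    exact hj₀ j
  rw [hnorm]
  -- The weights concentrate on an eigenvector for the largest eigenvalue as η tends to 0.
  refine exists_posDef_of_tendsto hV m (g := fun η j => (if j = j₀ then 1 else 0) + η)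
    (fun η hη j => add_pos_of_nonneg_of_pos (by split_ifs <;> norm_num) hη) ?_ hδ
  have hc : ContinuousAt (fun η : ℝ => ∑ j, (((if j = j₀ then 1 else 0) + η) /
      ∑ i, ((if i = j₀ then 1 else 0) + η)) ^ (-(-1) : ℝ) * m j) 0 := by
    simp only [neg_neg, Real.rpow_one]
    have hne : ∑ i, ((if i = j₀ then (1 : ℝ) else 0) + 0) ≠ 0 := by simp
    fun_prop (disch := assumption)
  have := hc.tendsto.mono_left (nhdsWithin_le_nhds (s := Set.Ioi 0))
  simpa using this

end Variational

/-! ### Evaluation of the optimized divergence and the sandwiched entropies. -/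

section Main

open Matrix

variable {S B : Type*} [Fintype S] [DecidableEq S] [Fintype B] [DecidableEq B]

theorem one_add_renyiExp {α : ℝ≥0∞} (hα : α ≠ ∞) (h0 : α ≠ 0) :
    1 + renyiExp α = 1 / α.toReal := by
  have h : α.toReal ≠ 0 := (ENNReal.toReal_pos h0 hα).ne'
  rw [renyiExp, if_neg hα]
  field_simp
  ring

theorem renyiExp_mem_of_one_lt {α : ℝ≥0∞} (h : 1 < α) : -1 ≤ renyiExp α ∧ renyiExp α < 0 := by
  by_cases hα : α = ∞
  · simp [renyiExp, hα]
  · have h1 : 1 < α.toReal := by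
      simpa using (ENNReal.toReal_lt_toReal ENNReal.one_ne_top hα).mpr h
    have h2 := one_add_renyiExp hα (one_pos.trans h).ne'
    have h3 : 0 < 1 / α.toReal := by positivity
    have h4 : 1 / α.toReal < 1 := (div_lt_one (by linarith)).mpr h1
    constructor <;> linarith

theorem renyiExp_mem_of_lt_one {α : ℝ≥0∞} (h2 : 1 / 2 ≤ α) (h : α < 1) :
    0 < renyiExp α ∧ renyiExp α ≤ 1 := by
  have hα : α ≠ ∞ := h.ne_top
  have h0 : α ≠ 0 := by
    rintro rfl
    simp at h2
  have h1 : α.toReal < 1 := by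
    simpa using (ENNReal.toReal_lt_toReal hα ENNReal.one_ne_top).mpr h
  have h3 : 1 / 2 ≤ α.toReal := by
    simpa using (ENNReal.toReal_le_toReal (by simp) hα).mpr h2
  have h4 := one_add_renyiExp hα h0
  have h5 : 1 < 1 / α.toReal := (one_lt_div (by linarith)).mpr h1
  have h6 : 1 / α.toReal ≤ 2 := by
    rw [div_le_iff₀ (by linarith)]
    linarith
  constructor <;> linarith

theorem alphaNorm_eq_powNorm {α : ℝ≥0∞} (hα : α ≠ ∞) (h0 : α ≠ 0) (M : Matrix S S ℂ) :
    alphaNorm α M = powNorm (renyiExp α) M := by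
  rw [alphaNorm, if_neg hα, powNorm, one_add_renyiExp hα h0, one_div, inv_inv]

theorem re_trace_rpow_mul_le_alphaNorm {α : ℝ≥0∞} (h : 1 < α) {M τ : Matrix S S ℂ}
    (hM : M.PosSemidef) (hτ : τ.PosDef) (hτ1 : τ.trace.re ≤ 1) :
    (psdPow τ (-renyiExp α) * M).trace.re ≤ alphaNorm α M := by
  by_cases hα : α = ∞
  · rw [hα, renyiExp, alphaNorm, if_pos rfl, if_pos rfl]
    exact re_trace_mul_le_euclNorm hM hτ hτ1
  · have h0 : α ≠ 0 := (one_pos.trans h).ne'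
    rw [alphaNorm_eq_powNorm hα h0]
    refine re_trace_rpow_mul_le_powNorm hM hτ hτ1 ?_ (renyiExp_mem_of_one_lt h).2
    have h1 := one_add_renyiExp hα h0
    have h2 : 0 < 1 / α.toReal := one_div_pos.mpr (ENNReal.toReal_pos h0 hα)
    linarith

theorem exists_posDef_alphaNorm {α : ℝ≥0∞} (h0 : α ≠ 0) {M : Matrix S S ℂ}
    (hM : M.PosSemidef) {δ : ℝ} (hδ : 0 < δ) :
    ∃ τ : Matrix S S ℂ, τ.PosDef ∧ τ.trace.re ≤ 1 ∧
      |(psdPow τ (-renyiExp α) * M).trace.re - alphaNorm α M| < δ := by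
  by_cases hα : α = ∞
  · rw [hα, renyiExp, alphaNorm, if_pos rfl, if_pos rfl]
    exact exists_posDef_euclNorm hM hδ
  · rw [alphaNorm_eq_powNorm hα h0]
    refine exists_posDef_powNorm hM ?_ hδ
    have h1 := one_add_renyiExp hα h0
    have h2 : 0 < 1 / α.toReal := one_div_pos.mpr (ENNReal.toReal_pos h0 hα)
    linarith

/-- The trace depends only on the eigenvalues with multiplicity, which are the roots of the
characteristic polynomial. -/
theorem trace_cfc_eq_of_charpoly_eq {C D : Matrix S S ℂ} (hC : C.IsHermitian)
    (hD : D.IsHermitian) (h : C.charpoly = D.charpoly) (f : ℝ → ℝ) :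
    (cfc f C).trace = (cfc f D).trace := by
  have key : ∀ {C : Matrix S S ℂ}, C.IsHermitian →
      (cfc f C).trace = (C.charpoly.roots.map fun z : ℂ => (f z.re : ℂ)).sum := by
    intro C hC
    rw [hC.roots_charpoly_eq_eigenvalues, Multiset.map_map]
    obtain ⟨U, d, hU, h1, hd⟩ := exists_conjDiag hC
    rw [← hd, h1, cfc_conjDiag hU, trace_conjDiag hU]
    push_cast
    rfl
  rw [key hC, key hD, h]

open scoped Matrix.Norms.L2Operator in
theorem euclNorm_conjTranspose_mul_self (A : Matrix S S ℂ) :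
    euclNorm (Aᴴ * A) = euclNorm (A * Aᴴ) := by
  have h : ‖Aᴴ * A‖ = ‖A * Aᴴ‖ := by
    exact (CStarRing.norm_star_mul_self (x := A)).trans (CStarRing.norm_self_mul_star (x := A)).symm
  exact h

theorem alphaNorm_conjTranspose_mul_self (α : ℝ≥0∞) (A : Matrix S S ℂ) :
    alphaNorm α (Aᴴ * A) = alphaNorm α (A * Aᴴ) := by
  unfold alphaNorm
  split_ifs
  · exact euclNorm_conjTranspose_mul_self A
  · rw [psdPow, psdPow, trace_cfc_eq_of_charpoly_eq (posSemidef_conjTranspose_mul_self A).isHermitian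
      (posSemidef_self_mul_conjTranspose A).isHermitian (charpoly_mul_comm _ _)]

variable {X Y : Matrix S S ℂ}

theorem sqrt_mul_mul_sqrt_posSemidef (hX : X.PosSemidef) {C : Matrix S S ℂ} (hC : C.PosSemidef) :
    (psdPow X (1 / 2) * C * psdPow X (1 / 2)).PosSemidef := by
  have h := hC.conjTranspose_mul_mul_same (psdPow X (1 / 2))
  rwa [(psdPow_posSemidef hX _).isHermitian.eq] at h

/-- Both arguments come from A = X^{1/2} Y^{p/2}: the sandwiched matrix is Aᴴ A and the matrix on
the right is A Aᴴ. -/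
theorem sandwichedNorm_eq (hX : X.PosSemidef) (hY : Y.PosSemidef) {α : ℝ≥0∞}
    (h0 : renyiExp α ≠ 0) :
    sandwichedNorm α X Y =
      alphaNorm α (psdPow X (1 / 2) * psdPow Y (renyiExp α) * psdPow X (1 / 2)) := by
  have hK : (psdPow X (1 / 2))ᴴ = psdPow X (1 / 2) := (psdPow_posSemidef hX _).isHermitian
  have hL : (psdPow Y (renyiExp α / 2))ᴴ = psdPow Y (renyiExp α / 2) :=
    (psdPow_posSemidef hY _).isHermitian
  have h := alphaNorm_conjTranspose_mul_self α (psdPow X (1 / 2) * psdPow Y (renyiExp α / 2))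
  rw [conjTranspose_mul, hK, hL] at h
  rw [sandwichedNorm, ← psdPow_half_mul_self hY h0]
  nth_rw 1 [← sqrt_mul_sqrt hX]
  simpa only [Matrix.mul_assoc] using h

/-- The two summands live on orthogonal subspaces, and the power of Y contributes nothing on ker Y.
-/
theorem psdPow_add_smul_kerProj (hY : Y.PosSemidef) {p : ℝ} (hp : p ≠ 0) (ε : ℝ) :
    psdPow (Y + (ε : ℂ) • kerProj Y) p = psdPow Y p + ((ε ^ p : ℝ) : ℂ) • kerProj Y := by
  obtain ⟨U, d, hU, rfl, hd⟩ := PosSemidef.exists_conjDiag hY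
  rw [kerProj, cfc_conjDiag hU, ← conjDiag_smul, ← conjDiag_add, psdPow_conjDiag hU,
    psdPow_conjDiag hU, ← conjDiag_smul, ← conjDiag_add]
  congr 1
  funext i
  by_cases h : d i = 0 <;> simp [h, Real.zero_rpow hp]

theorem fDivAt_rpow_add_smul_kerProj (hX : X.PosSemidef) (hY : Y.PosSemidef) {τ : Matrix S S ℂ}
    (hτ : τ.PosDef) {p : ℝ} (hp : p ≠ 0) {ε : ℝ} (hε : 0 < ε) :
    fDivAt (fun x => x ^ p) X (Y + (ε : ℂ) • kerProj Y) τ =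
      (psdPow τ (-p) * (psdPow X (1 / 2) * psdPow Y p * psdPow X (1 / 2))).trace.re +
      ε ^ p * (psdPow τ (-p) * (psdPow X (1 / 2) * kerProj Y * psdPow X (1 / 2))).trace.re := by
  rw [fDivAt_rpow hX (add_smul_kerProj_posDef hY hε) hτ, psdPow_add_smul_kerProj hY hp,
    ← Complex.re_ofReal_mul, ← Complex.add_re, ← smul_eq_mul (a := ((ε ^ p : ℝ) : ℂ)),
    ← trace_smul, ← trace_add]
  simp only [Matrix.mul_add, Matrix.add_mul, Matrix.mul_smul, Matrix.smul_mul, Matrix.mul_assoc]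

/-- With Π the projection onto ker Y, X^{1/2} Π X^{1/2} is the Gram matrix of Π X^{1/2}, so it
vanishes exactly when X Π = 0, that is, when ker Y ⊆ ker X; orthogonal complements reverse the
inclusion. -/
theorem supp_le_iff (hX : X.PosSemidef) (hY : Y.PosSemidef) :
    supp X ≤ supp Y ↔ psdPow X (1 / 2) * kerProj Y * psdPow X (1 / 2) = 0 := by
  have hK : (psdPow X (1 / 2))ᴴ = psdPow X (1 / 2) := (psdPow_posSemidef hX _).isHermitian
  have hP : (kerProj Y)ᴴ = kerProj Y := kerProj_isHermitian Y
  have h1 : psdPow X (1 / 2) * kerProj Y * psdPow X (1 / 2) = 0 ↔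
      kerProj Y * psdPow X (1 / 2) = 0 := by
    rw [← conjTranspose_mul_self_eq_zero (A := kerProj Y * psdPow X (1 / 2)), conjTranspose_mul,
      hK, hP, ← Matrix.mul_assoc, Matrix.mul_assoc _ (kerProj Y) (kerProj Y), kerProj_mul_self]
  have h2 : kerProj Y * psdPow X (1 / 2) = 0 ↔ X * kerProj Y = 0 := by
    constructor
    · intro h
      have h3 := congrArg conjTranspose h
      rw [conjTranspose_mul, hK, hP, conjTranspose_zero] at h3
      rw [← sqrt_mul_sqrt hX, Matrix.mul_assoc, h3, Matrix.mul_zero]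
    · intro h
      rw [← self_mul_conjTranspose_eq_zero (A := kerProj Y * psdPow X (1 / 2)),
        conjTranspose_mul, hK, hP, Matrix.mul_assoc, ← Matrix.mul_assoc (psdPow X (1 / 2)),
        sqrt_mul_sqrt hX, h, Matrix.mul_zero]
  rw [h1, h2, supp, supp, Submodule.orthogonal_le_orthogonal_iff]
  constructor
  · intro h
    rw [← mulVec_injective.eq_iff]
    funext v
    rw [zero_mulVec]
    have h3 : WithLp.toLp 2 (kerProj Y *ᵥ v) ∈ LinearMap.ker (toEuclideanLin Y) := by
      rw [LinearMap.mem_ker, toLpLin_apply, mulVec_mulVec, mul_kerProj hY.isHermitian,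
        zero_mulVec]
      rfl
    have h4 := h h3
    rw [LinearMap.mem_ker, toLpLin_apply, mulVec_mulVec] at h4
    exact congrArg WithLp.ofLp h4
  · intro h v hv
    rw [LinearMap.mem_ker, toLpLin_apply] at hv ⊢
    have hv' : Y *ᵥ v.ofLp = 0 := congrArg WithLp.ofLp hv
    rw [← (kerProj_mulVec_eq_self_iff hY.isHermitian _).mpr hv', mulVec_mulVec, h, zero_mulVec]
    rfl

theorem optFDiv_neg_rpow_eq (hX : X.PosSemidef) (hY : Y.PosSemidef) {α : ℝ≥0∞}
    (h2 : 1 / 2 ≤ α) (h1 : α < 1) :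
    optFDiv (fun x => -x ^ renyiExp α) X Y = ((-sandwichedNorm α X Y : ℝ) : EReal) := by
  obtain ⟨hp0, -⟩ := renyiExp_mem_of_lt_one h2 h1
  have h0 : α ≠ 0 := by
    rintro rfl
    simp at h2
  rw [sandwichedNorm_eq hX hY hp0.ne']
  set p := renyiExp α with hp
  set M := psdPow X (1 / 2) * psdPow Y p * psdPow X (1 / 2) with hMdef
  have hM : M.PosSemidef := sqrt_mul_mul_sqrt_posSemidef hX (psdPow_posSemidef hY p)
  have hE := sqrt_mul_mul_sqrt_posSemidef hX (kerProj_posSemidef hY)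
  set E := psdPow X (1 / 2) * kerProj Y * psdPow X (1 / 2) with hEdef
  refine le_antisymm (optFDiv_le_iff.mpr fun τ hτ hτ1 ε hε => ?_) ?_
  · rw [EReal.coe_le_coe_iff, fDivAt_neg, fDivAt_rpow_add_smul_kerProj hX hY hτ hp0.ne' hε,
      ← hMdef, ← hEdef, neg_le_neg_iff, alphaNorm_eq_powNorm h1.ne_top h0]
    have h3 := powNorm_le_re_trace_rpow_mul hM hτ hτ1 hp0
    have h4 : 0 ≤ (psdPow τ (-p) * E).trace.re := (Complex.le_def.mp
      (trace_mul_nonneg (psdPow_posSemidef hτ.posSemidef (-p)) hE)).1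
    have h5 := mul_nonneg (Real.rpow_nonneg hε.le p) h4
    rw [← hp]
    linarith
  · refine EReal.ge_of_forall_gt_iff_ge.mp fun b hb => ?_
    rw [EReal.coe_lt_coe_iff] at hb
    obtain ⟨τ, hτ, hτ1, hτM⟩ := exists_posDef_alphaNorm h0 hM (sub_pos.mpr hb)
    rw [← hp] at hτM
    have h3 : 0 ≤ (psdPow τ (-p) * E).trace.re := (Complex.le_def.mp
      (trace_mul_nonneg (psdPow_posSemidef hτ.posSemidef (-p)) hE)).1
    set c := (psdPow τ (-p) * E).trace.re with hc
    have h4 : 0 < -b - (psdPow τ (-p) * M).trace.re := by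
      have := (abs_lt.mp hτM).2
      linarith
    -- Here a is the value to be taken by ε^p, small enough for the kernel term a * c to fit into
    -- the remaining gap; the added 1 is needed because c may vanish.
    set a := (-b - (psdPow τ (-p) * M).trace.re) / (c + 1) with ha
    have ha0 : 0 < a := div_pos h4 (by linarith)
    have hac : a * c ≤ -b - (psdPow τ (-p) * M).trace.re := by
      rw [ha, div_mul_eq_mul_div, div_le_iff₀ (by linarith)]
      nlinarith
    have hε : 0 < a ^ p⁻¹ := Real.rpow_pos_of_pos ha0 _
    refine le_trans ?_ (le_optFDiv _ X Y hτ hτ1 hε)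
    rw [EReal.coe_le_coe_iff, fDivAt_neg, fDivAt_rpow_add_smul_kerProj hX hY hτ hp0.ne' hε,
      ← hMdef, ← hEdef, Real.rpow_inv_rpow ha0.le hp0.ne', ← hc]
    linarith

theorem optFDiv_rpow_eq (hX : X.PosSemidef) (hY : Y.PosSemidef) {α : ℝ≥0∞} (h1 : 1 < α)
    (hs : supp X ≤ supp Y) :
    optFDiv (fun x => x ^ renyiExp α) X Y = (sandwichedNorm α X Y : EReal) := by
  obtain ⟨-, hp0⟩ := renyiExp_mem_of_one_lt h1
  rw [sandwichedNorm_eq hX hY hp0.ne]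
  have hM := sqrt_mul_mul_sqrt_posSemidef hX (psdPow_posSemidef hY (renyiExp α))
  have hval : ∀ τ : Matrix S S ℂ, τ.PosDef → ∀ ε : ℝ, 0 < ε →
      fDivAt (fun x => x ^ renyiExp α) X (Y + (ε : ℂ) • kerProj Y) τ =
      (psdPow τ (-renyiExp α) *
        (psdPow X (1 / 2) * psdPow Y (renyiExp α) * psdPow X (1 / 2))).trace.re := by
    intro τ hτ ε hε
    -- Under the support condition the kernel term is zero, so the value does not depend on ε.
    rw [fDivAt_rpow_add_smul_kerProj hX hY hτ hp0.ne hε, (supp_le_iff hX hY).mp hs]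
    simp
  refine le_antisymm (optFDiv_le_iff.mpr fun τ hτ hτ1 ε hε => ?_) ?_
  · rw [hval τ hτ ε hε, EReal.coe_le_coe_iff]
    exact re_trace_rpow_mul_le_alphaNorm h1 hM hτ hτ1
  · refine EReal.ge_of_forall_gt_iff_ge.mp fun b hb => ?_
    rw [EReal.coe_lt_coe_iff] at hb
    obtain ⟨τ, hτ, hτ1, hτM⟩ := exists_posDef_alphaNorm (one_pos.trans h1).ne' hM (sub_pos.mpr hb)
    refine le_trans ?_ (le_optFDiv _ X Y hτ hτ1 one_pos)
    rw [hval τ hτ 1 one_pos, EReal.coe_le_coe_iff]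
    have := (abs_lt.mp hτM).1
    linarith

theorem psdPow_posDef {τ : Matrix S S ℂ} (hτ : τ.PosDef) (s : ℝ) : (psdPow τ s).PosDef := by
  obtain ⟨U, t, hU, rfl, ht⟩ := PosDef.exists_conjDiag hτ
  rw [psdPow_conjDiag hU]
  exact conjDiag_posDef hU fun i => Real.rpow_pos_of_pos (ht i) _

/-- C dominates some c > 0 times the identity, and a nonzero positive semi-definite E has positive
trace. -/
theorem re_trace_mul_pos {C E : Matrix S S ℂ} (hC : C.PosDef) (hE : E.PosSemidef) (hE0 : E ≠ 0) :
    0 < (C * E).trace.re := by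
  obtain ⟨c, hc, hcC⟩ := exists_smul_one_le hC
  have h := re_trace_mul_le hcC hE
  rw [Matrix.smul_mul, Matrix.one_mul, trace_smul, smul_eq_mul, Complex.re_ofReal_mul] at h
  have h1 := Complex.le_def.mp hE.trace_nonneg
  have h2 : E.trace.re ≠ 0 := fun h3 =>
    hE0 (hE.trace_eq_zero_iff.mp (Complex.ext h3 h1.2.symm))
  exact (mul_pos hc (lt_of_le_of_ne h1.1 h2.symm)).trans_le h

theorem optFDiv_rpow_eq_top (hX : X.PosSemidef) (hY : Y.PosSemidef) {α : ℝ≥0∞} (h1 : 1 < α)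
    (hs : ¬supp X ≤ supp Y) : optFDiv (fun x => x ^ renyiExp α) X Y = ⊤ := by
  obtain ⟨-, hp0⟩ := renyiExp_mem_of_one_lt h1
  have hM := sqrt_mul_mul_sqrt_posSemidef hX (psdPow_posSemidef hY (renyiExp α))
  have hE := sqrt_mul_mul_sqrt_posSemidef hX (kerProj_posSemidef hY)
  rw [supp_le_iff hX hY] at hs
  obtain ⟨τ, hτ, hτ1, -⟩ := exists_posDef_alphaNorm (one_pos.trans h1).ne' hM one_pos
  have hτp := psdPow_posDef hτ (-renyiExp α)
  have hM0 := (Complex.le_def.mp (trace_mul_nonneg hτp.posSemidef hM)).1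
  have hE0 := re_trace_mul_pos hτp hE hs
  rw [Complex.zero_re] at hM0
  refine top_le_iff.mp (EReal.ge_of_forall_gt_iff_ge.mp fun b _ => ?_)
  set e := (psdPow τ (-renyiExp α) * (psdPow X (1 / 2) * kerProj Y *
    psdPow X (1 / 2))).trace.re with he
  -- With ε^p equal to this quotient the kernel term alone is |b| + 1, and the other term is
  -- nonnegative.
  have ha0 : 0 < (|b| + 1) / e := div_pos (by positivity) hE0
  have hε : 0 < ((|b| + 1) / e) ^ (renyiExp α)⁻¹ := Real.rpow_pos_of_pos ha0 _
  refine le_trans ?_ (le_optFDiv _ X Y hτ hτ1 hε)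
  rw [EReal.coe_le_coe_iff, fDivAt_rpow_add_smul_kerProj hX hY hτ hp0.ne hε,
    Real.rpow_inv_rpow ha0.le hp0.ne, ← he, div_mul_cancel₀ _ hE0.ne']
  linarith [le_abs_self b]

theorem sandwichedEntropy_map_le {N : Matrix S S ℂ →ₗ[ℂ] Matrix B B ℂ} (hN : IsQuantumChannel N)
    (hX : X.PosSemidef) (hY : Y.PosSemidef) {α : ℝ≥0∞} (hα : (1 / 2 ≤ α ∧ α < 1) ∨ 1 < α) :
    sandwichedEntropy α (N X) (N Y) ≤ sandwichedEntropy α X Y := by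
  have hX' := hN.map_posSemidef hX
  have hY' := hN.map_posSemidef hY
  rcases hα with ⟨h2, h1⟩ | h1
  · obtain ⟨hp0, hp1⟩ := renyiExp_mem_of_lt_one h2 h1
    have h := optFDiv_neg_rpow_map_le hN hX hY hp0 hp1
    rw [optFDiv_neg_rpow_eq hX hY h2 h1, optFDiv_neg_rpow_eq hX' hY' h2 h1,
      EReal.coe_le_coe_iff, neg_le_neg_iff] at h
    -- For α < 1 both the divergence and the prefactor carry a negative sign, so the inequality
    -- between the norms is reversed twice.
    have hc : 0 ≤ -renyiPrefactor α := by
      rw [renyiPrefactor, if_neg h1.ne_top, neg_nonneg]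
      have h3 : α.toReal < 1 := by
        simpa using (ENNReal.toReal_lt_toReal h1.ne_top ENNReal.one_ne_top).mpr h1
      exact div_nonpos_of_nonneg_of_nonpos ENNReal.toReal_nonneg (by linarith)
    have hn : ¬1 < α := not_lt.mpr h1.le
    rw [sandwichedEntropy, sandwichedEntropy, if_neg fun h => hn h.1, if_neg fun h => hn h.1,
      ← EReal.neg_le_neg_iff, ← EReal.neg_mul, ← EReal.neg_mul, ← EReal.coe_neg]
    exact mul_le_mul_of_nonneg_left (ENNReal.log_monotone (ENNReal.ofReal_le_ofReal h))
      (EReal.coe_nonneg.mpr hc)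
  · by_cases hs : supp X ≤ supp Y
    · obtain ⟨hp1, hp0⟩ := renyiExp_mem_of_one_lt h1
      have h := optFDiv_rpow_map_le hN hX hY hp1 hp0
      rw [optFDiv_rpow_eq hX hY h1 hs] at h
      -- The support condition is inherited by the outputs: otherwise their divergence would be
      -- infinite while bounded by a finite one.
      have hs' : supp (N X) ≤ supp (N Y) := by
        by_contra hs'
        rw [optFDiv_rpow_eq_top hX' hY' h1 hs'] at h
        exact EReal.coe_ne_top _ (top_le_iff.mp h)
      rw [optFDiv_rpow_eq hX' hY' h1 hs', EReal.coe_le_coe_iff] at h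
      have hc : 0 ≤ renyiPrefactor α := by
        rw [renyiPrefactor]
        split_ifs with hα
        · exact zero_le_one
        · have h3 : 1 < α.toReal := by
            simpa using (ENNReal.toReal_lt_toReal ENNReal.one_ne_top hα).mpr h1
          exact div_nonneg ENNReal.toReal_nonneg (by linarith)
      rw [sandwichedEntropy, sandwichedEntropy, if_neg fun h => h.2 hs', if_neg fun h => h.2 hs]
      exact mul_le_mul_of_nonneg_left (ENNReal.log_monotone (ENNReal.ofReal_le_ofReal h))
        (EReal.coe_nonneg.mpr hc)
    · rw [sandwichedEntropy.eq_1 α X, if_pos ⟨h1, hs⟩]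
      exact le_top

end Main

end SandwichedRenyi

theorem mainTheorem4 {S B : Type*} [Fintype S] [DecidableEq S] [Fintype B] [DecidableEq B]
    (α : ℝ≥0∞) :
    (1 / 2 ≤ α → α < 1 →
      SandwichedRenyi.OperatorAntitone (fun x => -x ^ SandwichedRenyi.renyiExp α) ∧
      ∀ X Y : Matrix S S ℂ, X.PosSemidef → Y.PosSemidef →
        SandwichedRenyi.optFDiv (fun x => -x ^ SandwichedRenyi.renyiExp α) X Y =
          ((-SandwichedRenyi.sandwichedNorm α X Y : ℝ) : EReal)) ∧
    (1 < α →
      SandwichedRenyi.OperatorAntitone (fun x => x ^ SandwichedRenyi.renyiExp α) ∧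
      ∀ X Y : Matrix S S ℂ, X.PosSemidef → Y.PosSemidef →
        (SandwichedRenyi.supp X ≤ SandwichedRenyi.supp Y →
          SandwichedRenyi.optFDiv (fun x => x ^ SandwichedRenyi.renyiExp α) X Y =
            (SandwichedRenyi.sandwichedNorm α X Y : EReal)) ∧
        (¬ SandwichedRenyi.supp X ≤ SandwichedRenyi.supp Y →
          SandwichedRenyi.optFDiv (fun x => x ^ SandwichedRenyi.renyiExp α) X Y = ⊤)) ∧
    ((1 / 2 ≤ α ∧ α < 1) ∨ 1 < α →
      ∀ X Y : Matrix S S ℂ, X.PosSemidef → Y.PosSemidef →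
      ∀ N : Matrix S S ℂ →ₗ[ℂ] Matrix B B ℂ, SandwichedRenyi.IsQuantumChannel N →
        SandwichedRenyi.sandwichedEntropy α (N X) (N Y) ≤
          SandwichedRenyi.sandwichedEntropy α X Y) := by
  refine ⟨fun h2 h1 => ⟨?_, fun X Y hX hY => SandwichedRenyi.optFDiv_neg_rpow_eq hX hY h2 h1⟩,
    fun h1 => ⟨?_, fun X Y hX hY => ⟨SandwichedRenyi.optFDiv_rpow_eq hX hY h1,
      SandwichedRenyi.optFDiv_rpow_eq_top hX hY h1⟩⟩,
    fun hα X Y hX hY N hN => SandwichedRenyi.sandwichedEntropy_map_le hN hX hY hα⟩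
  · obtain ⟨hp0, hp1⟩ := SandwichedRenyi.renyiExp_mem_of_lt_one h2 h1
    exact SandwichedRenyi.operatorAntitone_neg_rpow hp0 hp1
  · obtain ⟨hp1, hp0⟩ := SandwichedRenyi.renyiExp_mem_of_one_lt h1
    exact SandwichedRenyi.operatorAntitone_rpow hp1 hp0
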